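/- Let $d\ge 1$ and let $\Omega\subset\mathbb{R}^d$ be open and bounded. Call $\Phi(x,s)=\int_0^s\varphi(x,t)\,dt$ ($x\in\Omega$, $s\ge 0$) a generalized $\Phi$-function if $\varphi(\cdot,s)$ is measurable on $\Omega$ for every $s\ge0$; for every $x\in\Omega$ the function $\varphi(x,\cdot)$ belongs to $C([0,\infty))\cap C^1((0,\infty))$ and is positive on $(0,\infty)$; and there are constants $p,q$ with $$0<p-1\le \frac{s\,\partial_s\varphi(x,s)}{\varphi(x,s)}\le q-1\qquad\text{for all }x\in\Omega,\ s>0 .$$ No continuity of $\Phi$ in $x$ is required. For a set $A$ put $$p^-_{\Phi,A}=\inf_{y\in A\cap\Omega,\ s>0}\frac{s\varphi(y,s)}{\Phi(y,s)},\qquad p^+_{\Phi,A}=\sup_{y\in A\cap\Omega,\ s>0}\frac{s\varphi(y,s)}{\Phi(y,s)},\qquad p^\pm_\Phi=p^\pm_{\Phi,\Omega}.$$ Write $\varrho_\Phi(u)=\int_\Omega\Phi(x,|u(x)|)\,dx$ and $\|u\|_{L^\Phi}=\inf\{\lambda>0:\varrho_\Phi(u/\lambda)\le1\}$. Let $L^\Phi(\Omega)$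 be the set of $u\in L^1(\Omega)$ with $\lim_{\lambda\to0}\varrho_\Phi(\lambda u)=0$, let $W^{1,\Phi}(\Omega)$ be the set of $u\in L^\Phi(\Omega)$ whose weak derivatives $\partial_1u,\dots,\partial_du$ belong to $L^\Phi(\Omega)$, with the norm $$\|u\|_{W^{1,\Phi}}=\inf\Big\{\lambda>0:\varrho_\Phi(u/\lambda)+\sum_{k=1}^d\varrho_\Phi(\partial_ku/\lambda)\le1\Big\},$$ and let $W^{1,\Phi}_0(\Omega)$ be the closure of $C_0^\infty(\Omega)$ in $W^{1,\Phi}(\Omega)$. **Theorem.** Let $\beta\in(0,1]$ and $\delta>0$, and let $\Phi$ be a generalized $\Phi$-function satisfying the normalization condition with constant $\beta$, $$\beta^{p^+_\Phi}\le\Phi(x,1)\le\beta^{-p^+_\Phi}\qquad\text{for a.e. }x\in\Omega,$$ and the jump condition with constant $\delta$: for every $x\in\Omega$, with $B=B_\delta(x)$, either $p^-_{\Phi,B}\ge d$, or $$p^-_{\Phi,B}<d\quad\text{and}\quad p^+_{\Phi,B}\le (p^-_{\Phi,B})^*:=\frac{d\,p^-_{\Phi,B}}{d-p^-_{\Phi,B}}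 .$$ Then there is a constant $c>0$ depending only on $\Omega,d,\delta,p^+_\Phi,p^-_\Phi,\beta$ such that for all $u\in W^{1,\Phi}_0(\Omega)$, $$\|u\|_{L^\Phi}\le c\,\big\|\,|\nabla u|\,\big\|_{L^\Phi}.$$ -/

import Mathlib

open MeasureTheory Filter Topology
open scoped ENNReal ContDiff

namespace MusielakOrlicz

noncomputable section

/-- Euclidean space `ℝ^d`. -/
abbrev E (d : ℕ) : Type := EuclideanSpace ℝ (Fin d)

variable {d : ℕ}

/-- The function `Φ(x, s) = ∫₀ˢ φ(x, t) dt` with density `φ`. -/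
def Phi (φ : E d → ℝ → ℝ) (x : E d) (s : ℝ) : ℝ := ∫ t in (0 : ℝ)..s, φ x t

/-- `Φ(x, s) = ∫₀ˢ φ(x, t) dt` is a generalized `Φ`-function on `Ω × [0, ∞)`.
For every `x ∈ Ω` the function `φ(x, ·)` is in `C([0,∞)) ∩ C¹((0,∞))`, is positive on `(0,∞)`, and
`0 < p - 1 ≤ s ∂ₛφ(x,s) / φ(x,s) ≤ q - 1` holds with constants `p, q` independent of `x` and `s`.
In the variable `x` only measurability is required, so that functions which jump in `x` are
included, as well as all `φ ∈ C(closure Ω × [0,∞)) ∩ C¹(Ω × (0,∞))`. -/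
structure IsGeneralizedPhi (Ω : Set (E d)) (φ : E d → ℝ → ℝ) : Prop where
  aemeasurable : ∀ s : ℝ, 0 ≤ s → AEMeasurable (fun x => φ x s) (volume.restrict Ω)
  continuousOn : ∀ x ∈ Ω, ContinuousOn (φ x) (Set.Ici 0)
  contDiffOn : ∀ x ∈ Ω, ContDiffOn ℝ 1 (φ x) (Set.Ioi 0)
  pos : ∀ x ∈ Ω, ∀ s : ℝ, 0 < s → 0 < φ x s
  growth : ∃ p q : ℝ, 0 < p - 1 ∧ ∀ x ∈ Ω, ∀ s : ℝ, 0 < s →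
    p - 1 ≤ s * deriv (φ x) s / φ x s ∧ s * deriv (φ x) s / φ x s ≤ q - 1

/-- The set of all quotients `s φ(y,s) / Φ(y,s)` with `y ∈ A ∩ Ω` and `s > 0`. -/
def quotients (Ω : Set (E d)) (φ : E d → ℝ → ℝ) (A : Set (E d)) : Set ℝ :=
  {r | ∃ y ∈ A ∩ Ω, ∃ s : ℝ, 0 < s ∧ r = s * φ y s / Phi φ y s}

/-- The lower exponent `p⁻_{Φ,A}`. -/
def pMinus (Ω : Set (E d)) (φ : E d → ℝ → ℝ) (A : Set (E d)) : ℝ := sInf (quotients Ω φ A)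

/-- The upper exponent `p⁺_{Φ,A}`. -/
def pPlus (Ω : Set (E d)) (φ : E d → ℝ → ℝ) (A : Set (E d)) : ℝ := sSup (quotients Ω φ A)

/-- The Sobolev conjugate exponent `p* = d p / (d - p)`, used for `0 < p < d`. -/
def sobolevConj (d : ℕ) (p : ℝ) : ℝ := (d : ℝ) * p / ((d : ℝ) - p)

/-- The jump condition with constant `δ`. -/
def JumpCondition (Ω : Set (E d)) (φ : E d → ℝ → ℝ) (δ : ℝ) : Prop :=
  ∀ x ∈ Ω, (d : ℝ) ≤ pMinus Ω φ (Metric.ball x δ) ∨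
    (pMinus Ω φ (Metric.ball x δ) < d ∧
      pPlus Ω φ (Metric.ball x δ) ≤ sobolevConj d (pMinus Ω φ (Metric.ball x δ)))

/-- The normalization condition with constant `β`:
`β^{p⁺} ≤ Φ(x,1) ≤ β^{-p⁺}` for almost every `x ∈ Ω`, where `p⁺ = p⁺_Φ`. -/
def Normalized (Ω : Set (E d)) (φ : E d → ℝ → ℝ) (β : ℝ) : Prop :=
  ∀ᵐ x ∂(volume.restrict Ω),
    β ^ (pPlus Ω φ Ω) ≤ Phi φ x 1 ∧ Phi φ x 1 ≤ β ^ (-(pPlus Ω φ Ω))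

/-- The modular `ϱ_Φ(u) = ∫_Ω Φ(x, |u(x)|) dx`, with values in `[0, ∞]`. -/
def modular (Ω : Set (E d)) (φ : E d → ℝ → ℝ) (u : E d → ℝ) : ℝ≥0∞ :=
  ∫⁻ x in Ω, ENNReal.ofReal (Phi φ x |u x|)

/-- Membership in the Musielak-Orlicz space `L^Φ(Ω)`. -/
def MemLPhi (Ω : Set (E d)) (φ : E d → ℝ → ℝ) (u : E d → ℝ) : Prop :=
  IntegrableOn u Ω ∧ Tendsto (fun l : ℝ => modular Ω φ (fun x => l * u x)) (𝓝[≠] 0) (𝓝 0)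

/-- The Luxemburg norm `‖u‖_{L^Φ} = inf {l > 0 : ϱ_Φ(u / l) ≤ 1}`; the infimum is taken in
`[0, ∞]`, so it is `∞` if there is no such `l`. -/
def normPhi (Ω : Set (E d)) (φ : E d → ℝ → ℝ) (u : E d → ℝ) : ℝ≥0∞ :=
  sInf {r | ∃ l : ℝ, 0 < l ∧ r = ENNReal.ofReal l ∧ modular Ω φ (fun x => u x / l) ≤ 1}

/-- `ψ ∈ C₀^∞(Ω)`: smooth with compact support contained in `Ω`. -/
def IsTestFunction (Ω : Set (E d)) (ψ : E d → ℝ) : Prop :=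
  ContDiff ℝ ∞ ψ ∧ HasCompactSupport ψ ∧ tsupport ψ ⊆ Ω

/-- The vector field `g` is the weak gradient of `u` in `Ω`
(for functions that are integrable over `Ω`, as are all functions in `L^Φ(Ω)`). -/
def HasWeakGradient (Ω : Set (E d)) (u : E d → ℝ) (g : E d → E d) : Prop :=
  IntegrableOn u Ω ∧ IntegrableOn g Ω ∧
    ∀ ψ : E d → ℝ, IsTestFunction Ω ψ → ∀ k : Fin d,
      ∫ x in Ω, u x * gradient ψ x k = -∫ x in Ω, g x k * ψ x

/-- `u ∈ W^{1,Φ}(Ω)`, with weak gradient `g`. -/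
def MemW1Phi (Ω : Set (E d)) (φ : E d → ℝ → ℝ) (u : E d → ℝ) (g : E d → E d) : Prop :=
  MemLPhi Ω φ u ∧ HasWeakGradient Ω u g ∧ ∀ k : Fin d, MemLPhi Ω φ (fun x => g x k)

/-- The modular `ϱ_{1,Φ}(u) = ϱ_Φ(u) + ∑ₖ ϱ_Φ(∂ₖu)` of a function `u` with weak gradient `g`. -/
def modularW1 (Ω : Set (E d)) (φ : E d → ℝ → ℝ) (u : E d → ℝ) (g : E d → E d) : ℝ≥0∞ :=
  modular Ω φ u + ∑ k : Fin d, modular Ω φ (fun x => g x k)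

/-- The norm `‖u‖_{W^{1,Φ}}` of a function `u` with weak gradient `g`. -/
def normW1Phi (Ω : Set (E d)) (φ : E d → ℝ → ℝ) (u : E d → ℝ) (g : E d → E d) : ℝ≥0∞ :=
  sInf {r | ∃ l : ℝ, 0 < l ∧ r = ENNReal.ofReal l ∧
    modularW1 Ω φ (fun x => u x / l) (fun x => l⁻¹ • g x) ≤ 1}

/-- `u ∈ W₀^{1,Φ}(Ω)`, with weak gradient `g`: `u` lies in the closure of `C₀^∞(Ω)` in
`W^{1,Φ}(Ω)`. -/
def MemW1PhiZero (Ω : Set (E d)) (φ : E d → ℝ → ℝ) (u : E d → ℝ) (g : E d → E d) : Prop :=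
  MemW1Phi Ω φ u g ∧ ∀ ε : ℝ≥0∞, 0 < ε → ∃ ψ : E d → ℝ, IsTestFunction Ω ψ ∧
    normW1Phi Ω φ (fun x => u x - ψ x) (fun x => g x - gradient ψ x) < ε

end

end MusielakOrlicz

/-! ### Growth and measurability of `Φ`. -/

namespace MusielakOrlicz
section Growth
variable {d : ℕ} {Ω A : Set (E d)} {φ : E d → ℝ → ℝ} {x : E d} {s t l a b : ℝ}

/-! On a small ball `Φ` is squeezed between two powers, and the jump condition says exactly that
Sobolev's inequality bridges them. Let `p`, `q` be the lower and upper exponents on `B = B_δ(y)`.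
Normalization gives `s^p ≲ 1 + Φ(x,s)` and `Φ(x,s) ≲ 1 + s^q` there. A modular bound for `∇ψ`
therefore bounds `∇ψ` in `L^p(B)` (`eLpNorm_fderiv_le`), Sobolev bounds `ψ` in `L^q` of the half
ball, and this bounds the modular of `ψ` there (`setLIntegral_Phi_le`). Finitely many half balls
cover `Ω`.

The constant must not depend on `Φ` beyond its global exponents, although `p` and `q` vary with the
ball and the Sobolev constant blows up as `p → d`. Since `q ≤ p⁺_Φ`, it is enough to use the
exponent `min p p₀`, with `p₀ < d` fixed and `p₀* ≥ p⁺_Φ` (`exists_sobolev_ball`). Localizing costs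
a lower order term in `ψ`; bootstrapping lowers it to an `L¹` norm, and a global `L¹` Poincaré
inequality turns that into `∇ψ` (`exists_sobolev_poincare`).

A general `u` needs no limit: one test function at distance less than `l` from `u` suffices, by the
quasi-triangle inequality for modulars. Finally, as `p⁻ ≥ 1`, a modular bound `C ≥ 1` becomes a norm
bound with the same `C`. -/

@[simp] theorem Phi_zero : Phi φ x 0 = 0 := by simp [Phi]

namespace IsGeneralizedPhi

theorem intervalIntegrable (h : IsGeneralizedPhi Ω φ) (hx : x ∈ Ω) (hs : 0 ≤ s) :
    IntervalIntegrable (φ x) volume 0 s :=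
  ((h.continuousOn x hx).mono (by
    rw [Set.uIcc_of_le hs]; exact Set.Icc_subset_Ici_self)).intervalIntegrable

theorem hasDerivAt_Phi (h : IsGeneralizedPhi Ω φ) (hx : x ∈ Ω) (hs : 0 < s) :
    HasDerivAt (Phi φ x) (φ x s) s := by
  have hc : ContinuousOn (φ x) (Set.Ioi 0) := (h.continuousOn x hx).mono Set.Ioi_subset_Ici_self
  exact intervalIntegral.integral_hasDerivAt_right (h.intervalIntegrable hx hs.le)
    (hc.stronglyMeasurableAtFilter isOpen_Ioi s hs) (hc.continuousAt (Ioi_mem_nhds hs))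

theorem continuousOn_Phi (h : IsGeneralizedPhi Ω φ) (hx : x ∈ Ω) :
    ContinuousOn (Phi φ x) (Set.Ici 0) := by
  intro s hs
  rcases (Set.mem_Ici.1 hs).eq_or_lt with rfl | hs
  · have h1 := intervalIntegral.continuousOn_primitive_interval
      (f := φ x) (μ := volume) (a := 0) (b := 1) (by
        simpa [intervalIntegrable_iff, Set.uIcc_of_le, Set.uIoc_of_le,
          integrableOn_Icc_iff_integrableOn_Ioc] using h.intervalIntegrable hx zero_le_one)
    have h2 := h1 0 (by simp)
    rw [Set.uIcc_of_le zero_le_one] at h2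
    exact h2.mono_of_mem_nhdsWithin (Icc_mem_nhdsGE one_pos)
  · exact (h.hasDerivAt_Phi hx hs).continuousAt.continuousWithinAt

theorem Phi_pos (h : IsGeneralizedPhi Ω φ) (hx : x ∈ Ω) (hs : 0 < s) : 0 < Phi φ x s :=
  intervalIntegral.intervalIntegral_pos_of_pos_on (h.intervalIntegrable hx hs.le)
    (fun t ht => h.pos x hx t ht.1) hs

theorem Phi_nonneg (h : IsGeneralizedPhi Ω φ) (hx : x ∈ Ω) (hs : 0 ≤ s) : 0 ≤ Phi φ x s := by
  rcases hs.eq_or_lt with rfl | hs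
  · simp
  · exact (h.Phi_pos hx hs).le

theorem differentiableAt (h : IsGeneralizedPhi Ω φ) (hx : x ∈ Ω) (hs : 0 < s) :
    DifferentiableAt ℝ (φ x) s :=
  ((h.contDiffOn x hx).differentiableOn one_ne_zero).differentiableAt (Ioi_mem_nhds hs)

/-- The bounds for `s ∂ₛφ / φ` pass to the quotient `s φ / Φ`. -/
theorem exists_quotient_bounds (h : IsGeneralizedPhi Ω φ) :
    ∃ p q : ℝ, 1 < p ∧ ∀ x ∈ Ω, ∀ s, 0 < s →
      p ≤ s * φ x s / Phi φ x s ∧ s * φ x s / Phi φ x s ≤ q := by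
  obtain ⟨p, q, hp, hpq⟩ := h.growth
  refine ⟨p, q, by linarith, fun x hx s hs => ?_⟩
  -- `s φ - r Φ` vanishes at `0` and has derivative `φ + s ∂ₛφ - r φ`, which the growth hypothesis
  -- makes nonnegative for `r = p` and nonpositive for `r = q`.
  have hcont : ∀ r : ℝ, ContinuousOn (fun s => s * φ x s - r * Phi φ x s) (Set.Ici 0) :=
    fun r => (continuousOn_id.mul (h.continuousOn x hx)).sub
      (continuousOn_const.mul (h.continuousOn_Phi hx))
  have hder : ∀ r s : ℝ, 0 < s → HasDerivAt (fun s => s * φ x s - r * Phi φ x s)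
      (1 * φ x s + s * deriv (φ x) s - r * φ x s) s := fun r s hs =>
    ((hasDerivAt_id s).mul (h.differentiableAt hx hs).hasDerivAt).sub
      ((h.hasDerivAt_Phi hx hs).const_mul r)
  have hb : ∀ s, 0 < s → (p - 1) * φ x s ≤ s * deriv (φ x) s ∧
      s * deriv (φ x) s ≤ (q - 1) * φ x s := fun s hs => by
    have := hpq x hx s hs
    rwa [le_div_iff₀ (h.pos x hx s hs), div_le_iff₀ (h.pos x hx s hs)] at this
  rw [le_div_iff₀ (h.Phi_pos hx hs), div_le_iff₀ (h.Phi_pos hx hs)]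
  constructor
  · have hm : MonotoneOn (fun s => s * φ x s - p * Phi φ x s) (Set.Ici 0) := by
      refine monotoneOn_of_deriv_nonneg (convex_Ici 0) (hcont p) (fun s hs => ?_) fun s hs => ?_
      all_goals rw [interior_Ici] at hs
      · exact (hder p s hs).differentiableAt.differentiableWithinAt
      · rw [(hder p s hs).deriv]; linarith [(hb s hs).1]
    have := hm Set.self_mem_Ici hs.le hs.le
    simp only [zero_mul, Phi_zero, mul_zero, sub_zero] at this
    linarith
  · have hm : AntitoneOn (fun s => s * φ x s - q * Phi φ x s) (Set.Ici 0) := by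
      refine antitoneOn_of_deriv_nonpos (convex_Ici 0) (hcont q) (fun s hs => ?_) fun s hs => ?_
      all_goals rw [interior_Ici] at hs
      · exact (hder q s hs).differentiableAt.differentiableWithinAt
      · rw [(hder q s hs).deriv]; linarith [(hb s hs).2]
    have := hm Set.self_mem_Ici hs.le hs.le
    simp only [zero_mul, Phi_zero, mul_zero, sub_zero] at this
    linarith

theorem bddBelow_quotients (h : IsGeneralizedPhi Ω φ) (A : Set (E d)) :
    BddBelow (quotients Ω φ A) := by
  obtain ⟨p, q, -, hpq⟩ := h.exists_quotient_bounds
  refine ⟨p, ?_⟩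
  rintro _ ⟨y, hy, s, hs, rfl⟩
  exact (hpq y hy.2 s hs).1

theorem bddAbove_quotients (h : IsGeneralizedPhi Ω φ) (A : Set (E d)) :
    BddAbove (quotients Ω φ A) := by
  obtain ⟨p, q, -, hpq⟩ := h.exists_quotient_bounds
  refine ⟨q, ?_⟩
  rintro _ ⟨y, hy, s, hs, rfl⟩
  exact (hpq y hy.2 s hs).2

theorem pMinus_mul_Phi_le (h : IsGeneralizedPhi Ω φ) (hx : x ∈ A ∩ Ω) (hs : 0 < s) :
    pMinus Ω φ A * Phi φ x s ≤ s * φ x s := by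
  rw [← le_div_iff₀ (h.Phi_pos hx.2 hs)]
  exact csInf_le (h.bddBelow_quotients A) ⟨x, hx, s, hs, rfl⟩

theorem le_pPlus_mul_Phi (h : IsGeneralizedPhi Ω φ) (hx : x ∈ A ∩ Ω) (hs : 0 < s) :
    s * φ x s ≤ pPlus Ω φ A * Phi φ x s := by
  rw [← div_le_iff₀ (h.Phi_pos hx.2 hs)]
  exact le_csSup (h.bddAbove_quotients A) ⟨x, hx, s, hs, rfl⟩

/-- Nonemptiness matters: over an empty set the `sInf` takes the default value `0`. -/
theorem one_le_pMinus (h : IsGeneralizedPhi Ω φ) (hA : (A ∩ Ω).Nonempty) :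
    1 ≤ pMinus Ω φ A := by
  obtain ⟨p, q, hp, hpq⟩ := h.exists_quotient_bounds
  obtain ⟨y, hy⟩ := hA
  refine le_csInf ⟨_, y, hy, 1, one_pos, rfl⟩ ?_
  rintro _ ⟨y, hy, s, hs, rfl⟩
  exact hp.le.trans (hpq y hy.2 s hs).1

theorem pMinus_le_pPlus (h : IsGeneralizedPhi Ω φ) (hA : (A ∩ Ω).Nonempty) :
    pMinus Ω φ A ≤ pPlus Ω φ A := by
  obtain ⟨y, hy⟩ := hA
  exact (csInf_le (h.bddBelow_quotients A) ⟨y, hy, 1, one_pos, rfl⟩).trans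
    (le_csSup (h.bddAbove_quotients A) ⟨y, hy, 1, one_pos, rfl⟩)

theorem pPlus_le (h : IsGeneralizedPhi Ω φ) (hA : (A ∩ Ω).Nonempty) :
    pPlus Ω φ A ≤ pPlus Ω φ Ω := by
  obtain ⟨y, hy⟩ := hA
  refine csSup_le_csSup (h.bddAbove_quotients Ω) ⟨_, y, hy, 1, one_pos, rfl⟩ ?_
  rintro _ ⟨y, hy, s, hs, rfl⟩
  exact ⟨y, ⟨hy.2, hy.2⟩, s, hs, rfl⟩

/-- The logarithmic derivative of `r ↦ Φ(x,r) r^(-p⁻)` is `(r φ/Φ - p⁻)/r ≥ 0`, so this function is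
nondecreasing; compare `r = s` with `r = l s`. With `p⁺` the sign reverses, which gives
`Phi_mul_le`. -/
theorem rpow_mul_Phi_le (h : IsGeneralizedPhi Ω φ) (hx : x ∈ A ∩ Ω) (hs : 0 ≤ s) (hl : 1 ≤ l) :
    l ^ pMinus Ω φ A * Phi φ x s ≤ Phi φ x (l * s) := by
  rcases hs.eq_or_lt with rfl | hs
  · simp
  set a := pMinus Ω φ A with ha
  have hder : ∀ r : ℝ, 0 < r → HasDerivAt (fun r => Phi φ x r * r ^ (-a))
      (φ x r * r ^ (-a) + Phi φ x r * (-a * r ^ (-a - 1))) r := fun r hr =>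
    (h.hasDerivAt_Phi hx.2 hr).mul (Real.hasDerivAt_rpow_const (Or.inl hr.ne'))
  have hm : MonotoneOn (fun r => Phi φ x r * r ^ (-a)) (Set.Ioi 0) := by
    refine monotoneOn_of_deriv_nonneg (convex_Ioi 0)
      (fun r hr => (hder r hr).continuousAt.continuousWithinAt) (fun r hr => ?_) fun r hr => ?_
    all_goals rw [interior_Ioi] at hr
    · exact (hder r hr).differentiableAt.differentiableWithinAt
    · have hr : 0 < r := hr
      rw [(hder r hr).deriv]
      have e : r ^ (-a) = r * r ^ (-a - 1) := by
        rw [Real.rpow_sub_one hr.ne']; field_simp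
      rw [e]
      have := h.pMinus_mul_Phi_le hx hr
      have h2 : 0 ≤ r ^ (-a - 1) := by positivity
      nlinarith [mul_nonneg (sub_nonneg.2 this) h2]
  have hl0 : 0 < l := one_pos.trans_le hl
  have := hm hs (mul_pos hl0 hs : l * s ∈ Set.Ioi 0) (le_mul_of_one_le_left hs.le hl)
  simp only at this
  rw [Real.mul_rpow hl0.le hs.le, ← mul_assoc] at this
  have h3 := le_of_mul_le_mul_right this (by positivity)
  rw [Real.rpow_neg hl0.le, ← div_eq_mul_inv, le_div_iff₀ (by positivity)] at h3
  linarith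

theorem Phi_mul_le (h : IsGeneralizedPhi Ω φ) (hx : x ∈ A ∩ Ω) (hs : 0 ≤ s) (hl : 1 ≤ l) :
    Phi φ x (l * s) ≤ l ^ pPlus Ω φ A * Phi φ x s := by
  rcases hs.eq_or_lt with rfl | hs
  · simp
  set a := pPlus Ω φ A with ha
  have hder : ∀ r : ℝ, 0 < r → HasDerivAt (fun r => Phi φ x r * r ^ (-a))
      (φ x r * r ^ (-a) + Phi φ x r * (-a * r ^ (-a - 1))) r := fun r hr =>
    (h.hasDerivAt_Phi hx.2 hr).mul (Real.hasDerivAt_rpow_const (Or.inl hr.ne'))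
  have hm : AntitoneOn (fun r => Phi φ x r * r ^ (-a)) (Set.Ioi 0) := by
    refine antitoneOn_of_deriv_nonpos (convex_Ioi 0)
      (fun r hr => (hder r hr).continuousAt.continuousWithinAt) (fun r hr => ?_) fun r hr => ?_
    all_goals rw [interior_Ioi] at hr
    · exact (hder r hr).differentiableAt.differentiableWithinAt
    · have hr : 0 < r := hr
      rw [(hder r hr).deriv]
      have e : r ^ (-a) = r * r ^ (-a - 1) := by
        rw [Real.rpow_sub_one hr.ne']; field_simp
      rw [e]
      have := h.le_pPlus_mul_Phi hx hr
      have h2 : 0 ≤ r ^ (-a - 1) := by positivity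
      nlinarith [mul_nonneg (sub_nonneg.2 this) h2]
  have hl0 : 0 < l := one_pos.trans_le hl
  have := hm hs (mul_pos hl0 hs : l * s ∈ Set.Ioi 0) (le_mul_of_one_le_left hs.le hl)
  simp only at this
  rw [Real.mul_rpow hl0.le hs.le, ← mul_assoc] at this
  have h3 := le_of_mul_le_mul_right this (by positivity)
  rw [Real.rpow_neg hl0.le, ← div_eq_mul_inv, div_le_iff₀ (by positivity)] at h3
  linarith

theorem Phi_mono (h : IsGeneralizedPhi Ω φ) (hx : x ∈ Ω) (hs : 0 ≤ s) (hst : s ≤ t) :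
    Phi φ x s ≤ Phi φ x t := by
  rcases hs.eq_or_lt with rfl | hs
  · rw [Phi_zero]; exact h.Phi_nonneg hx hst
  have hl : 1 ≤ t / s := (one_le_div hs).2 hst
  have h1 := h.rpow_mul_Phi_le (A := Ω) ⟨hx, hx⟩ hs.le hl
  rw [div_mul_cancel₀ _ hs.ne'] at h1
  have h2 : 1 ≤ (t / s) ^ pMinus Ω φ Ω :=
    Real.one_le_rpow hl (zero_le_one.trans (h.one_le_pMinus ⟨x, hx, hx⟩))
  exact (le_mul_of_one_le_left (h.Phi_nonneg hx hs.le) h2).trans h1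

/-- The `Δ₂`-condition, in the form of a quasi-triangle inequality. -/
theorem Phi_add_le (h : IsGeneralizedPhi Ω φ) (hx : x ∈ Ω) (hs : 0 ≤ s) (ht : 0 ≤ t) :
    Phi φ x (s + t) ≤ 2 ^ pPlus Ω φ Ω * (Phi φ x s + Phi φ x t) := by
  have h0 : 0 ≤ max s t := hs.trans (le_max_left _ _)
  calc Phi φ x (s + t) ≤ Phi φ x (2 * max s t) :=
        h.Phi_mono hx (by positivity) (by linarith [le_max_left s t, le_max_right s t])
    _ ≤ 2 ^ pPlus Ω φ Ω * Phi φ x (max s t) := h.Phi_mul_le ⟨hx, hx⟩ h0 one_le_two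
    _ ≤ _ := by
        gcongr
        have := h.Phi_nonneg hx hs
        have := h.Phi_nonneg hx ht
        rcases max_choice s t with e | e <;> rw [e] <;> linarith

/-- `s^{p⁻} Φ(x,1) ≤ Φ(x,1) + Φ(x,s)`. -/
theorem rpow_mul_Phi_one_le (h : IsGeneralizedPhi Ω φ) (hx : x ∈ A ∩ Ω) (hs : 0 ≤ s) :
    s ^ pMinus Ω φ A * Phi φ x 1 ≤ Phi φ x 1 + Phi φ x s := by
  have h1 := h.Phi_pos hx.2 one_pos
  have h2 := h.Phi_nonneg hx.2 hs
  rcases le_total s 1 with hs1 | hs1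
  · have : s ^ pMinus Ω φ A ≤ 1 :=
      Real.rpow_le_one hs hs1 (zero_le_one.trans (h.one_le_pMinus ⟨x, hx⟩))
    nlinarith
  · have := h.rpow_mul_Phi_le hx zero_le_one hs1
    rw [mul_one] at this
    linarith

/-- `Φ(x,s) ≤ Φ(x,1) (1 + s^{p⁺})`. -/
theorem Phi_le_mul_one_add_rpow (h : IsGeneralizedPhi Ω φ) (hx : x ∈ A ∩ Ω) (hs : 0 ≤ s) :
    Phi φ x s ≤ Phi φ x 1 * (1 + s ^ pPlus Ω φ A) := by
  have h1 := h.Phi_pos hx.2 one_pos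
  have h2 : 0 ≤ s ^ pPlus Ω φ A := by positivity
  rcases le_total s 1 with hs1 | hs1
  · have := h.Phi_mono hx.2 hs hs1
    nlinarith
  · have := h.Phi_mul_le hx zero_le_one hs1
    rw [mul_one] at this
    nlinarith

/-- Composition with a measurable function (`Φ` is a Carathéodory function). -/
theorem aemeasurable_Phi_comp (h : IsGeneralizedPhi Ω φ) (hΩ : MeasurableSet Ω) {f : E d → ℝ}
    (hf : AEMeasurable f (volume.restrict Ω)) (hf0 : ∀ x, 0 ≤ f x) :
    AEMeasurable (fun x => Phi φ x (f x)) (volume.restrict Ω) := by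
  -- The null set where `φ(·,s)` differs from a measurable function depends on `s`. Rational `s`
  -- leave a single null set `T`, and continuity in `s` recovers the other values off `T`. The `max`
  -- with `0` stays in the range where hypotheses on `φ` are available.
  have hq : ∀ q : ℚ, AEMeasurable (fun x => φ x (max (q : ℝ) 0)) (volume.restrict Ω) :=
    fun q => h.aemeasurable _ (le_max_right _ _)
  have hae : ∀ᵐ x ∂(volume.restrict Ω), ∀ q : ℚ, φ x (max (q : ℝ) 0) = (hq q).mk _ x :=
    ae_all_iff.2 fun q => (hq q).ae_eq_mk
  obtain ⟨T, hTsub, hT, hT0⟩ := exists_measurable_superset_of_null (ae_iff.1 hae)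
  have hTq : ∀ x ∉ T, ∀ q : ℚ, φ x (max (q : ℝ) 0) = (hq q).mk _ x := fun x hx => by
    by_contra hne
    exact hx (hTsub hne)
  set S := Ω \ T with hS
  have hSm : MeasurableSet S := hΩ.diff hT
  let F : ℝ → E d → ℝ := fun s => S.indicator fun x => φ x (max s 0)
  have hFc : ∀ x, Continuous fun s => F s x := by
    intro x
    by_cases hx : x ∈ S
    · simp only [F, Set.indicator_of_mem hx]
      exact (h.continuousOn x hx.1).comp_continuous (continuous_id.max continuous_const)
        fun s => Set.mem_Ici.2 (le_max_right s 0)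
    · simp only [F, Set.indicator_of_notMem hx]
      exact continuous_const
  have hFq : ∀ q : ℚ, Measurable (F q) := by
    intro q
    have : F q = S.indicator ((hq q).mk _) := Set.indicator_congr fun x hx => hTq x hx.2 q
    rw [this]
    exact (hq q).measurable_mk.indicator hSm
  have hFm : ∀ s, Measurable (F s) := by
    intro s
    obtain ⟨r, -, -, hr⟩ := Real.exists_seq_rat_strictMono_tendsto s
    exact measurable_of_tendsto_metrizable (fun n => hFq (r n))
      (tendsto_pi_nhds.2 fun x => ((hFc x).tendsto s).comp hr)
  have hFj : Measurable (Function.uncurry F) := measurable_uncurry_of_continuous_of_measurable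
    hFc hFm
  let g := hf.mk f
  have hg : Measurable g := hf.measurable_mk
  -- `Φ(x, f x)` is the integral over `t` of a jointly measurable function cut off to the region
  -- under the graph of `f`, hence measurable in `x`.
  let D : Set (E d × ℝ) := {z | 0 < z.2 ∧ z.2 ≤ g z.1}
  have hD : MeasurableSet D := (measurableSet_lt measurable_const measurable_snd).inter
    (measurableSet_le measurable_snd (hg.comp measurable_fst))
  have hH : StronglyMeasurable fun x => ∫ t, D.indicator (fun z => F z.2 z.1) (x, t) :=
    StronglyMeasurable.integral_prod_right
      ((hFj.comp measurable_swap).indicator hD).stronglyMeasurable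
  refine ⟨_, hH.measurable, ?_⟩
  have hT' : ∀ᵐ x ∂(volume.restrict Ω), x ∉ T := measure_eq_zero_iff_ae_notMem.1 hT0
  filter_upwards [hf.ae_eq_mk, hT', ae_restrict_mem hΩ] with x hx hxT hxΩ
  have hxS : x ∈ S := ⟨hxΩ, hxT⟩
  rw [Phi, intervalIntegral.integral_of_le (hf0 x), ← integral_indicator measurableSet_Ioc]
  congr 1
  ext t
  have hxg : g x = f x := hx.symm
  by_cases ht : t ∈ Set.Ioc 0 (f x)
  · have : (x, t) ∈ D := ⟨ht.1, by simpa [hxg] using ht.2⟩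
    rw [Set.indicator_of_mem ht, Set.indicator_of_mem this]
    simp only [F, Set.indicator_of_mem hxS]
    rw [max_eq_left ht.1.le]
  · have : (x, t) ∉ D := fun hD => ht ⟨hD.1, by simpa [hxg] using hD.2⟩
    rw [Set.indicator_of_notMem ht, Set.indicator_of_notMem this]

end IsGeneralizedPhi

end Growth
end MusielakOrlicz

/-! ### Sobolev and Poincaré inequalities uniform in the exponents. -/

namespace MusielakOrlicz
section Sobolev
open scoped NNReal
variable {d : ℕ}

/-- On a set of finite measure `L^q` embeds into `L^p` for `1 ≤ p ≤ q`, with a constant that does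
not depend on the exponents. -/
theorem eLpNorm_restrict_le_max_one_mul {F : Type*} [NormedAddCommGroup F] {A : Set (E d)}
    {p q : ℝ≥0∞} (hp : 1 ≤ p) (hpq : p ≤ q) {f : E d → F}
    (hf : AEStronglyMeasurable f (volume.restrict A)) :
    eLpNorm f p (volume.restrict A) ≤ max 1 (volume A) * eLpNorm f q (volume.restrict A) := by
  have h1 : (1 : ℝ) / p.toReal ≤ 1 := by
    rcases eq_or_ne p ⊤ with rfl | h
    · simp
    · have : (1 : ℝ) ≤ p.toReal := by
        simpa using ENNReal.toReal_mono h hp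
      exact (div_le_one (by linarith)).2 this
  have h2 : (0 : ℝ) ≤ 1 / q.toReal := by positivity
  have h3 : (0 : ℝ) ≤ 1 / p.toReal - 1 / q.toReal := by
    rcases eq_or_ne q ⊤ with rfl | h
    · simp
    · have h4 : (0 : ℝ) < p.toReal :=
        ENNReal.toReal_pos (one_pos.trans_le hp).ne' (ne_top_of_le_ne_top h hpq)
      exact sub_nonneg.2 (one_div_le_one_div_of_le h4 (ENNReal.toReal_mono h hpq))
  refine (eLpNorm_le_eLpNorm_mul_rpow_measure_univ hpq hf).trans ?_
  rw [mul_comm, Measure.restrict_apply_univ]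
  gcongr
  -- The Hölder exponent lies in `[0,1]`, so the power is at most `max 1 |A|`.
  calc volume A ^ (1 / p.toReal - 1 / q.toReal)
      ≤ (max 1 (volume A)) ^ (1 / p.toReal - 1 / q.toReal) := by
        gcongr; exact le_max_right _ _
    _ ≤ (max 1 (volume A)) ^ (1 : ℝ) := by
        apply ENNReal.rpow_le_rpow_of_exponent_le (le_max_left _ _); linarith
    _ = _ := ENNReal.rpow_one _

theorem eLpNorm_ball_mono {F : Type*} [NormedAddCommGroup F] (f : E d → F) (p : ℝ≥0∞) (c : E d)
    {ρ ρ' : ℝ} (h : ρ ≤ ρ') :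
    eLpNorm f p (volume.restrict (Metric.ball c ρ)) ≤
      eLpNorm f p (volume.restrict (Metric.ball c ρ')) :=
  eLpNorm_mono_measure _ (Measure.restrict_mono (Metric.ball_subset_ball h) le_rfl)

/-- The Gagliardo-Nirenberg-Sobolev inequality with a constant that is uniform for exponents
`1 ≤ t ≤ p₀ < d`. -/
theorem exists_uniform_gns {p₀ : ℝ≥0} (hp₀d : p₀ < d) :
    ∃ C : ℝ≥0, ∀ t t' : ℝ≥0, 1 ≤ t → t ≤ p₀ → (t' : ℝ)⁻¹ = (t : ℝ)⁻¹ - (d : ℝ)⁻¹ →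
      ∀ ψ : E d → ℝ, ContDiff ℝ 1 ψ → HasCompactSupport ψ →
        eLpNorm ψ t' volume ≤ C * eLpNorm (fderiv ℝ ψ) t volume := by
  have hp₀d' : (p₀ : ℝ) < d := by exact_mod_cast hp₀d
  -- The constant for exponent `t` contains the factor `t (d-1)/(d-t)`, which increases in `t`; its
  -- value at `p₀` serves all `t ≤ p₀`.
  refine ⟨eLpNormLESNormFDerivOneConst (volume : Measure (E d)) (NNReal.conjExponent d) *
    (p₀ * (d - 1) / (d - p₀) : ℝ).toNNReal, fun t t' ht htp htt ψ hψ hψc => ?_⟩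
  have ht1 : (1 : ℝ) ≤ t := by exact_mod_cast ht
  have htp' : (t : ℝ) ≤ p₀ := by exact_mod_cast htp
  have hfr : Module.finrank ℝ (E d) = d := by simp
  have hd : 0 < d := by
    rw [← Nat.cast_pos (α := ℝ)]; linarith
  refine (eLpNorm_le_eLpNorm_fderiv_of_eq_inner volume hψ hψc ht (by rw [hfr]; exact hd)
    (by rw [hfr]; exact_mod_cast htt)).trans ?_
  rw [eLpNormLESNormFDerivOfEqInnerConst]
  simp only [hfr]
  have : (1 : ℝ) ≤ d := by exact_mod_cast hd
  have : (0 : ℝ) ≤ d - 1 := by linarith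
  gcongr

/-- Apply the global inequality to `ψ` times a cutoff that is `1` on the inner ball; the derivative
of the cutoff produces the term without gradient. Translating one fixed bump makes the constant
independent of the centre. -/
theorem exists_local_sobolev {p₀ : ℝ≥0} (hp₀d : p₀ < d) {ρ ρ' : ℝ}
    (hρ : 0 < ρ) (hρ' : ρ < ρ') :
    ∃ C : ℝ≥0, ∀ c : E d, ∀ t t' : ℝ≥0, 1 ≤ t → t ≤ p₀ →
      (t' : ℝ)⁻¹ = (t : ℝ)⁻¹ - (d : ℝ)⁻¹ → ∀ ψ : E d → ℝ, ContDiff ℝ 1 ψ →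
        eLpNorm ψ t' (volume.restrict (Metric.ball c ρ)) ≤
          C * (eLpNorm (fderiv ℝ ψ) t (volume.restrict (Metric.ball c ρ')) +
            eLpNorm ψ t (volume.restrict (Metric.ball c ρ'))) := by
  obtain ⟨C, hC⟩ := exists_uniform_gns hp₀d
  let b : ContDiffBump (0 : E d) := ⟨ρ, (ρ + ρ') / 2, hρ, by linarith⟩
  have hbs : ContDiff ℝ 1 b := b.contDiff
  obtain ⟨K, hK⟩ := (b.hasCompactSupport.fderiv ℝ).exists_bound_of_continuous
    (hbs.continuous_fderiv one_ne_zero)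
  have hK0 : 0 ≤ K := (norm_nonneg _).trans (hK 0)
  refine ⟨C * max 1 K.toNNReal, fun c t t' ht htp htt ψ hψ => ?_⟩
  let η : E d → ℝ := fun x => b (x - c)
  have hη : ContDiff ℝ 1 η := hbs.comp (contDiff_id.sub contDiff_const)
  let v : E d → ℝ := fun x => η x * ψ x
  have hv : ContDiff ℝ 1 v := hη.mul hψ
  have hηsupp : tsupport η ⊆ Metric.closedBall c ((ρ + ρ') / 2) := by
    refine closure_minimal (fun x hx => ?_) Metric.isClosed_closedBall
    have : x - c ∈ Function.support b := hx
    rw [b.support_eq] at this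
    rw [Metric.mem_closedBall, dist_eq_norm]
    simpa [b] using (Metric.mem_ball.1 this).le
  have hvsupp : tsupport v ⊆ Metric.closedBall c ((ρ + ρ') / 2) :=
    (closure_mono (Function.support_mul_subset_left _ _)).trans hηsupp
  have hvc : HasCompactSupport v :=
    HasCompactSupport.of_support_subset_isCompact (isCompact_closedBall c ((ρ + ρ') / 2))
      ((subset_tsupport v).trans hvsupp)
  have hsub : Metric.closedBall c ((ρ + ρ') / 2) ⊆ Metric.ball c ρ' :=
    Metric.closedBall_subset_ball (by linarith)
  have h1 : eLpNorm ψ t' (volume.restrict (Metric.ball c ρ)) ≤ eLpNorm v t' volume := by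
    have : eLpNorm ψ t' (volume.restrict (Metric.ball c ρ)) =
        eLpNorm v t' (volume.restrict (Metric.ball c ρ)) := by
      refine eLpNorm_congr_ae ((ae_restrict_iff' measurableSet_ball).2 (ae_of_all _ ?_))
      intro x hx
      have : b (x - c) = 1 := b.one_of_mem_closedBall (by
        rw [Metric.mem_closedBall, dist_zero_right, ← dist_eq_norm]
        exact (Metric.mem_ball.1 hx).le)
      simp [v, η, this]
    rw [this]
    exact eLpNorm_mono_measure _ Measure.restrict_le_self
  have h2 : ∀ x, ‖fderiv ℝ v x‖ ≤ ‖‖fderiv ℝ ψ x‖ + K * ‖ψ x‖‖ := by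
    intro x
    have hd : fderiv ℝ v x = η x • fderiv ℝ ψ x + ψ x • fderiv ℝ η x :=
      fderiv_mul (hη.differentiable one_ne_zero x) (hψ.differentiable one_ne_zero x)
    have hηd : ‖fderiv ℝ η x‖ ≤ K := by
      have : fderiv ℝ η x = fderiv ℝ b (x - c) := fderiv_comp_sub c
      rw [this]; exact hK _
    have hη1 : ‖η x‖ ≤ 1 := by
      rw [Real.norm_of_nonneg b.nonneg]; exact b.le_one
    rw [hd, Real.norm_of_nonneg (by positivity)]
    refine (norm_add_le _ _).trans ?_
    rw [norm_smul, norm_smul]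
    have := norm_nonneg (fderiv ℝ ψ x)
    have := norm_nonneg (ψ x)
    nlinarith
  have hsuppd : Function.support (fderiv ℝ v) ⊆ Metric.ball c ρ' :=
    ((subset_tsupport _).trans (tsupport_fderiv_subset ℝ)).trans (hvsupp.trans hsub)
  have hm : AEStronglyMeasurable (fun x => ‖fderiv ℝ ψ x‖)
      (volume.restrict (Metric.ball c ρ')) :=
    (hψ.continuous_fderiv one_ne_zero).norm.aestronglyMeasurable
  have hm2 : AEStronglyMeasurable (fun x => K * ‖ψ x‖)
      (volume.restrict (Metric.ball c ρ')) :=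
    (continuous_const.mul hψ.continuous.norm).aestronglyMeasurable
  calc eLpNorm ψ t' (volume.restrict (Metric.ball c ρ)) ≤ eLpNorm v t' volume := h1
    _ ≤ C * eLpNorm (fderiv ℝ v) t volume := hC t t' ht htp htt v hv hvc
    _ = C * eLpNorm (fderiv ℝ v) t (volume.restrict (Metric.ball c ρ')) := by
        congr 1
        exact (eLpNorm_restrict_eq_of_support_subset
          (f := fun x => fderiv ℝ v x) hsuppd).symm
    _ ≤ C * eLpNorm (fun x => ‖fderiv ℝ ψ x‖ + K * ‖ψ x‖) t
          (volume.restrict (Metric.ball c ρ')) := by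
        gcongr; exact eLpNorm_mono h2
    _ ≤ C * (eLpNorm (fun x => ‖fderiv ℝ ψ x‖) t (volume.restrict (Metric.ball c ρ')) +
          eLpNorm (fun x => K * ‖ψ x‖) t (volume.restrict (Metric.ball c ρ'))) := by
        gcongr; exact eLpNorm_add_le hm hm2 (by exact_mod_cast ht)
    _ ≤ C * (max 1 K.toNNReal * eLpNorm (fderiv ℝ ψ) t (volume.restrict (Metric.ball c ρ')) +
          max 1 K.toNNReal * eLpNorm ψ t (volume.restrict (Metric.ball c ρ'))) := by
        have e1 : eLpNorm (fun x => K * ‖ψ x‖) t (volume.restrict (Metric.ball c ρ')) =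
            K.toNNReal * eLpNorm ψ t (volume.restrict (Metric.ball c ρ')) := by
          have := eLpNorm_const_smul (p := (t : ℝ≥0∞)) K (fun x => ‖ψ x‖)
            (volume.restrict (Metric.ball c ρ'))
          rw [eLpNorm_norm] at this
          refine this.trans ?_
          rw [Real.enorm_eq_ofReal hK0]; rfl
        rw [eLpNorm_norm, e1]
        gcongr
        · exact le_mul_of_one_le_left' (by exact_mod_cast le_max_left _ _)
        · exact le_max_right _ _
    _ = _ := by push_cast; ring

/-- Sobolev bootstrapping on concentric balls from `L¹` up to `L^t`. -/
theorem exists_bootstrap (hd : 2 ≤ d) {p₀ : ℝ≥0} (hp₀d : p₀ < d) (k : ℕ) :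
    ∀ {ρ ρ' : ℝ}, 0 < ρ → ρ < ρ' → ∃ C : ℝ≥0, ∀ c : E d, ∀ t : ℝ≥0, 1 ≤ t → t ≤ p₀ →
      ∀ ψ : E d → ℝ, ContDiff ℝ 1 ψ →
        eLpNorm ψ (min t ((d / (d - 1) : ℝ≥0) ^ k) : ℝ≥0)
            (volume.restrict (Metric.ball c ρ)) ≤
          C * (eLpNorm (fderiv ℝ ψ) t (volume.restrict (Metric.ball c ρ')) +
            eLpNorm ψ 1 (volume.restrict (Metric.ball c ρ'))) := by
  have hdR : (2 : ℝ) ≤ d := by exact_mod_cast hd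
  have hd1 : (1 : ℝ≥0) ≤ d := by exact_mod_cast (by omega : 1 ≤ d)
  have hd2 : (1 : ℝ≥0) < d := by exact_mod_cast (by omega : 1 < d)
  have hbase : (1 : ℝ≥0) ≤ d / (d - 1) := by
    rw [le_div_iff₀ (tsub_pos_of_lt hd2)]; simp
  induction k with
  | zero =>
    intro ρ ρ' hρ hρ'
    refine ⟨1, fun c t ht htp ψ hψ => ?_⟩
    simp only [pow_zero, min_eq_right ht, ENNReal.coe_one, one_mul]
    exact (eLpNorm_ball_mono ψ 1 c hρ'.le).trans le_add_self
  | succ k ih =>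
    intro ρ ρ' hρ hρ'
    obtain ⟨C₁, hC₁⟩ := exists_local_sobolev (d := d) hp₀d hρ (by linarith : ρ < (ρ + ρ') / 2)
    obtain ⟨C₂, hC₂⟩ := ih (by linarith : 0 < (ρ + ρ') / 2) (by linarith : (ρ + ρ') / 2 < ρ')
    set V : ℝ≥0∞ := max 1 (volume (Metric.ball (0 : E d) ρ')) with hV
    have hVtop : V ≠ ⊤ := by
      simp only [hV, ne_eq, max_eq_top, ENNReal.one_ne_top, false_or]
      exact measure_ball_lt_top.ne
    have hVball : ∀ c : E d, ∀ r ≤ ρ', max 1 (volume (Metric.ball c r)) ≤ V := by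
      intro c r hr
      rw [hV, Measure.addHaar_ball_center]
      gcongr
    refine ⟨V.toNNReal * C₁ * (V.toNNReal + C₂), fun c t ht htp ψ hψ => ?_⟩
    push_cast
    rw [ENNReal.coe_toNNReal hVtop]
    set τ : ℝ≥0 := min t ((d / (d - 1) : ℝ≥0) ^ k) with hτ
    have hτ1 : 1 ≤ τ := le_min ht (one_le_pow₀ hbase)
    have hτt : τ ≤ t := min_le_left _ _
    have hτp : τ ≤ p₀ := hτt.trans htp
    have hτR : (1 : ℝ) ≤ τ := by exact_mod_cast hτ1
    have hτd : (τ : ℝ) < d := by exact_mod_cast hτp.trans_lt hp₀d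
    let τ' : ℝ≥0 := ⟨d * τ / (d - τ), div_nonneg (by positivity) (by linarith)⟩
    have hτ' : (τ' : ℝ)⁻¹ = (τ : ℝ)⁻¹ - (d : ℝ)⁻¹ := by
      change (d * τ / (d - τ) : ℝ)⁻¹ = _
      field_simp
    -- Since `τ ≥ 1`, the conjugate `dτ/(d-τ)` is at least `dτ/(d-1)`: each round gains at least the
    -- factor `d/(d-1)`.
    have hle : min t ((d / (d - 1) : ℝ≥0) ^ (k + 1)) ≤ τ' := by
      have h1 : min t ((d / (d - 1) : ℝ≥0) ^ (k + 1)) ≤ (d / (d - 1)) * τ := by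
        rw [hτ, mul_min_of_nonneg _ _ (by positivity), pow_succ']
        exact min_le_min_right _ (le_mul_of_one_le_left' hbase)
      refine h1.trans ?_
      rw [← NNReal.coe_le_coe]
      push_cast [NNReal.coe_sub hd1]
      change (d / (d - 1) * τ : ℝ) ≤ d * τ / (d - τ)
      rw [div_mul_eq_mul_div]
      gcongr
    calc eLpNorm ψ (min t ((d / (d - 1) : ℝ≥0) ^ (k + 1)) : ℝ≥0)
            (volume.restrict (Metric.ball c ρ))
        ≤ V * eLpNorm ψ τ' (volume.restrict (Metric.ball c ρ)) := by
          refine (eLpNorm_restrict_le_max_one_mul ?_ (ENNReal.coe_le_coe.2 hle)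
            hψ.continuous.aestronglyMeasurable).trans ?_
          · exact_mod_cast le_min ht (one_le_pow₀ hbase)
          · gcongr; exact hVball c ρ hρ'.le
      _ ≤ V * (C₁ * (eLpNorm (fderiv ℝ ψ) τ (volume.restrict (Metric.ball c ((ρ + ρ') / 2))) +
            eLpNorm ψ τ (volume.restrict (Metric.ball c ((ρ + ρ') / 2))))) := by
          gcongr; exact hC₁ c τ τ' hτ1 hτp hτ' ψ hψ
      _ ≤ V * (C₁ * (V * eLpNorm (fderiv ℝ ψ) t (volume.restrict (Metric.ball c ρ')) +
            C₂ * (eLpNorm (fderiv ℝ ψ) t (volume.restrict (Metric.ball c ρ')) +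
            eLpNorm ψ 1 (volume.restrict (Metric.ball c ρ'))))) := by
          gcongr
          · refine (eLpNorm_ball_mono _ _ c (by linarith : (ρ + ρ') / 2 ≤ ρ')).trans ?_
            refine (eLpNorm_restrict_le_max_one_mul (by exact_mod_cast hτ1)
              (ENNReal.coe_le_coe.2 hτt)
              (hψ.continuous_fderiv one_ne_zero).aestronglyMeasurable).trans ?_
            gcongr; exact hVball c ρ' le_rfl
          · exact hC₂ c t ht htp ψ hψ
      _ ≤ V * (C₁ * (V * (eLpNorm (fderiv ℝ ψ) t (volume.restrict (Metric.ball c ρ')) +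
            eLpNorm ψ 1 (volume.restrict (Metric.ball c ρ'))) +
            C₂ * (eLpNorm (fderiv ℝ ψ) t (volume.restrict (Metric.ball c ρ')) +
            eLpNorm ψ 1 (volume.restrict (Metric.ball c ρ'))))) := by
          gcongr; exact le_self_add
      _ = _ := by ring

/-- The Sobolev inequality on balls, uniformly in the exponents `p` and `q ≤ Q`, `q ≤ p*`. -/
theorem exists_sobolev_ball (hd : 2 ≤ d) (Q : ℝ≥0) {δ : ℝ} (hδ : 0 < δ) :
    ∃ C : ℝ≥0, ∀ c : E d, ∀ p q : ℝ≥0, 1 ≤ p → 1 ≤ q → q ≤ Q →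
      ((d : ℝ) ≤ p ∨ (p : ℝ) < d ∧ (q : ℝ) ≤ sobolevConj d p) →
      ∀ ψ : E d → ℝ, ContDiff ℝ 1 ψ →
        eLpNorm ψ q (volume.restrict (Metric.ball c (δ / 2))) ≤
          C * (eLpNorm (fderiv ℝ ψ) p (volume.restrict (Metric.ball c δ)) +
            eLpNorm ψ 1 (volume.restrict (Metric.ball c δ))) := by
  have hdR : (2 : ℝ) ≤ d := by exact_mod_cast hd
  -- `p₀` is the exponent whose Sobolev conjugate is `Q'`. Taking `Q' ≥ 2` together with `d ≥ 2`
  -- ensures `p₀ ≥ 1`.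
  set Q' : ℝ≥0 := max Q 2 with hQ'
  have hQ2 : (2 : ℝ) ≤ Q' := by exact_mod_cast le_max_right Q 2
  set p₀ : ℝ≥0 := d * Q' / (d + Q') with hp₀
  have hp₀R : (p₀ : ℝ) = d * Q' / (d + Q') := by simp [hp₀]
  have hp₀d : p₀ < d := by
    rw [← NNReal.coe_lt_coe, hp₀R, NNReal.coe_natCast, div_lt_iff₀ (by positivity)]
    nlinarith
  have hp₀d' : (p₀ : ℝ) < d := by exact_mod_cast hp₀d
  have hp₀1 : 1 ≤ p₀ := by
    rw [← NNReal.coe_le_coe, hp₀R, NNReal.coe_one, le_div_iff₀ (by positivity)]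
    nlinarith
  have hp₀conj : (d * p₀ / (d - p₀) : ℝ) = Q' := by
    have : (d : ℝ) - p₀ = d ^ 2 / (d + Q') := by rw [hp₀R]; field_simp; ring
    rw [this, hp₀R]; field_simp
  have hd2 : (1 : ℝ≥0) < d := by exact_mod_cast (by omega : 1 < d)
  have hd1 : (1 : ℝ≥0) ≤ d := hd2.le
  have hbase : (1 : ℝ≥0) < d / (d - 1) := by
    rw [lt_div_iff₀ (tsub_pos_of_lt hd2), one_mul]
    exact tsub_lt_self (by positivity) one_pos
  obtain ⟨k, hk⟩ := pow_unbounded_of_one_lt p₀ hbase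
  obtain ⟨C₁, hC₁⟩ := exists_local_sobolev (d := d) hp₀d (by linarith : 0 < δ / 2)
    (by linarith : δ / 2 < 3 * δ / 4)
  obtain ⟨C₂, hC₂⟩ := exists_bootstrap hd hp₀d k (by linarith : 0 < 3 * δ / 4)
    (by linarith : 3 * δ / 4 < δ)
  set V : ℝ≥0∞ := max 1 (volume (Metric.ball (0 : E d) δ)) with hV
  have hVtop : V ≠ ⊤ := by
    simp only [hV, ne_eq, max_eq_top, ENNReal.one_ne_top, false_or]
    exact measure_ball_lt_top.ne
  have hV1 : 1 ≤ V := le_max_left _ _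
  have hVball : ∀ c : E d, ∀ r ≤ δ, max 1 (volume (Metric.ball c r)) ≤ V := by
    intro c r hr
    rw [hV, Measure.addHaar_ball_center]
    gcongr
  refine ⟨V.toNNReal * C₁ * (1 + C₂) * V.toNNReal, fun c p q hp hq hqQ hpq ψ hψ => ?_⟩
  push_cast
  rw [ENNReal.coe_toNNReal hVtop]
  -- If `p ≤ p₀ < d`, then `t = p` and the hypothesis gives `q ≤ p*`; otherwise `t = p₀` and `q ≤ Q
  -- ≤ p₀*`.
  set t : ℝ≥0 := min p p₀ with ht
  have ht1 : 1 ≤ t := le_min hp hp₀1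
  have htp : t ≤ p₀ := min_le_right _ _
  have htR : (1 : ℝ) ≤ t := by exact_mod_cast ht1
  have htd : (t : ℝ) < d := by exact_mod_cast htp.trans_lt hp₀d
  let t' : ℝ≥0 := ⟨d * t / (d - t), div_nonneg (by positivity) (by linarith)⟩
  have ht' : (t' : ℝ)⁻¹ = (t : ℝ)⁻¹ - (d : ℝ)⁻¹ := by
    change (d * t / (d - t) : ℝ)⁻¹ = _
    field_simp
  have hqt : q ≤ t' := by
    rw [← NNReal.coe_le_coe]
    change (q : ℝ) ≤ d * t / (d - t)
    rcases le_total p p₀ with h | h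
    · have htp' : t = p := min_eq_left h
      rw [htp'] at htd ⊢
      rcases hpq with h' | h'
      · linarith
      · exact h'.2
    · have htp' : t = p₀ := min_eq_right h
      rw [htp', hp₀conj]
      exact_mod_cast hqQ.trans (le_max_left _ _)
  have hmin : min t ((d / (d - 1) : ℝ≥0) ^ k) = t := min_eq_left (htp.trans hk.le)
  have hboot := hC₂ c t ht1 htp ψ hψ
  rw [hmin] at hboot
  calc eLpNorm ψ q (volume.restrict (Metric.ball c (δ / 2)))
      ≤ V * eLpNorm ψ t' (volume.restrict (Metric.ball c (δ / 2))) := by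
        refine (eLpNorm_restrict_le_max_one_mul (by exact_mod_cast hq) (ENNReal.coe_le_coe.2 hqt)
            hψ.continuous.aestronglyMeasurable).trans ?_
        gcongr; exact hVball c _ (by linarith)
    _ ≤ V * (C₁ * (eLpNorm (fderiv ℝ ψ) t (volume.restrict (Metric.ball c (3 * δ / 4))) +
          eLpNorm ψ t (volume.restrict (Metric.ball c (3 * δ / 4))))) := by
        gcongr; exact hC₁ c t t' ht1 htp ht' ψ hψ
    _ ≤ V * (C₁ * ((eLpNorm (fderiv ℝ ψ) t (volume.restrict (Metric.ball c δ)) +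
          eLpNorm ψ 1 (volume.restrict (Metric.ball c δ))) +
          C₂ * (eLpNorm (fderiv ℝ ψ) t (volume.restrict (Metric.ball c δ)) +
          eLpNorm ψ 1 (volume.restrict (Metric.ball c δ))))) := by
        gcongr
        exact (eLpNorm_ball_mono _ _ c (by linarith : 3 * δ / 4 ≤ δ)).trans le_self_add
    _ = V * C₁ * (1 + C₂) * (eLpNorm (fderiv ℝ ψ) t (volume.restrict (Metric.ball c δ)) +
          eLpNorm ψ 1 (volume.restrict (Metric.ball c δ))) := by ring
    _ ≤ V * C₁ * (1 + C₂) * (V * eLpNorm (fderiv ℝ ψ) p (volume.restrict (Metric.ball c δ)) +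
          V * eLpNorm ψ 1 (volume.restrict (Metric.ball c δ))) := by
        gcongr
        · refine (eLpNorm_restrict_le_max_one_mul (by exact_mod_cast ht1)
              (ENNReal.coe_le_coe.2 (min_le_left p p₀))
              (hψ.continuous_fderiv one_ne_zero).aestronglyMeasurable).trans ?_
          gcongr; exact hVball c δ le_rfl
        · exact le_mul_of_one_le_left' hV1
    _ = _ := by ring

/-- The Poincaré inequality in `L¹` for functions with compact support in a bounded set. -/
theorem exists_poincare_one (hd : 2 ≤ d) {Ω : Set (E d)} (hΩb : Bornology.IsBounded Ω) :
    ∃ C : ℝ≥0, ∀ ψ : E d → ℝ, ContDiff ℝ 1 ψ → HasCompactSupport ψ → tsupport ψ ⊆ Ω →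
      eLpNorm ψ 1 volume ≤ C * eLpNorm (fderiv ℝ ψ) 1 volume := by
  have hdR : (2 : ℝ) ≤ d := by exact_mod_cast hd
  obtain ⟨C, hC⟩ := exists_uniform_gns (d := d) (p₀ := 1)
    (by exact_mod_cast (by omega : 1 < d))
  have hV : max 1 (volume Ω) ≠ ⊤ := by
    simp only [ne_eq, max_eq_top, ENNReal.one_ne_top, false_or]
    exact hΩb.measure_lt_top.ne
  refine ⟨(max 1 (volume Ω)).toNNReal * C, fun ψ hψ hψc hψs => ?_⟩
  push_cast
  rw [ENNReal.coe_toNNReal hV]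
  -- This is the Sobolev conjugate of `1`; Hölder on the bounded set `Ω` then returns to `L¹`.
  let t' : ℝ≥0 := ⟨d / (d - 1), div_nonneg (by positivity) (by linarith)⟩
  have ht' : (t' : ℝ)⁻¹ = ((1 : ℝ≥0) : ℝ)⁻¹ - (d : ℝ)⁻¹ := by
    change (d / (d - 1) : ℝ)⁻¹ = _
    simp only [NNReal.coe_one]
    field_simp
  have h1t : 1 ≤ t' := by
    rw [← NNReal.coe_le_coe]
    change (1 : ℝ) ≤ d / (d - 1)
    rw [le_div_iff₀ (by linarith)]; linarith
  have hs : Function.support ψ ⊆ Ω := (subset_tsupport ψ).trans hψs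
  calc eLpNorm ψ 1 volume = eLpNorm ψ 1 (volume.restrict Ω) := by
        rw [eLpNorm_restrict_eq_of_support_subset hs]
    _ ≤ max 1 (volume Ω) * eLpNorm ψ t' (volume.restrict Ω) :=
        eLpNorm_restrict_le_max_one_mul le_rfl (by exact_mod_cast h1t)
          hψ.continuous.aestronglyMeasurable
    _ ≤ max 1 (volume Ω) * (C * eLpNorm (fderiv ℝ ψ) (1 : ℝ≥0) volume) := by
        gcongr
        exact (eLpNorm_mono_measure _ Measure.restrict_le_self).trans
          (hC 1 t' le_rfl le_rfl ht' ψ hψ hψc)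
    _ = _ := by rw [mul_assoc]; rfl

/-- In dimension one the supremum is bounded by the `L¹`-norm of the derivative. -/
theorem enorm_le_eLpNorm_fderiv_one {ψ : E 1 → ℝ} (hψ : ContDiff ℝ 1 ψ)
    (hψc : HasCompactSupport ψ) (x : E 1) : ‖ψ x‖ₑ ≤ eLpNorm (fderiv ℝ ψ) 1 volume := by
  let v : E 1 := EuclideanSpace.single 0 1
  have hv : ‖v‖ = 1 := by simp [v]
  let e : ℝ ≃ₗᵢ[ℝ] E 1 :=
    (LinearIsometry.toSpanSingleton ℝ (E 1) hv).toLinearIsometryEquiv (by simp)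
  have he : ∀ t, HasDerivAt e v t := fun t => by
    have : HasDerivAt (fun t : ℝ => t • v) ((1 : ℝ) • v) t := (hasDerivAt_id t).smul_const v
    rw [one_smul] at this
    exact this
  have hf : ContDiff ℝ 1 (ψ ∘ e) := hψ.comp e.contDiff
  have hfc : HasCompactSupport (ψ ∘ e) := hψc.comp_homeomorph e.toHomeomorph
  calc ‖ψ x‖ₑ = ‖(ψ ∘ e) (e.symm x)‖ₑ := by simp
    _ ≤ ∫⁻ y in Set.Iic (e.symm x), ‖deriv (ψ ∘ e) y‖ₑ :=
        HasCompactSupport.enorm_le_lintegral_Ici_deriv hf hfc _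
    _ ≤ ∫⁻ y, ‖deriv (ψ ∘ e) y‖ₑ := setLIntegral_le_lintegral _ _
    _ ≤ ∫⁻ y, ‖fderiv ℝ ψ (e y)‖ₑ := by
        refine lintegral_mono fun y => ?_
        have : deriv (ψ ∘ e) y = fderiv ℝ ψ (e y) v :=
          ((hψ.differentiable one_ne_zero (e y)).hasFDerivAt.comp_hasDerivAt y (he y)).deriv
        rw [this]
        refine (ContinuousLinearMap.le_opENorm _ _).trans ?_
        rw [← ofReal_norm v, hv]; simp
    _ = ∫⁻ y, ‖fderiv ℝ ψ y‖ₑ :=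
        e.measurePreserving.lintegral_comp
          (hψ.continuous_fderiv one_ne_zero).enorm.measurable
    _ = _ := eLpNorm_one_eq_lintegral_enorm.symm

/-- Combination of the Sobolev inequality on balls and the Poincaré inequality in `L¹`. -/
theorem exists_sobolev_poincare (hd : 1 ≤ d) {Ω : Set (E d)} (hΩb : Bornology.IsBounded Ω)
    (Q : ℝ≥0) {δ : ℝ} (hδ : 0 < δ) :
    ∃ C : ℝ≥0, ∀ c : E d, ∀ p q : ℝ≥0, 1 ≤ p → 1 ≤ q → q ≤ Q →
      ((d : ℝ) ≤ p ∨ (p : ℝ) < d ∧ (q : ℝ) ≤ sobolevConj d p) →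
      ∀ ψ : E d → ℝ, ContDiff ℝ 1 ψ → HasCompactSupport ψ → tsupport ψ ⊆ Ω →
        eLpNorm ψ q (volume.restrict (Metric.ball c (δ / 2))) ≤
          C * (eLpNorm (fderiv ℝ ψ) p (volume.restrict (Metric.ball c δ)) +
            eLpNorm (fderiv ℝ ψ) 1 volume) := by
  rcases hd.eq_or_lt with rfl | hd
  -- For `d = 1` no exponent satisfies `1 ≤ p₀ < d`, but the supremum bound controls every `L^q`
  -- norm.
  · have hVtop : max 1 (volume (Metric.ball (0 : E 1) (δ / 2))) ≠ ⊤ := by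
      simp only [ne_eq, max_eq_top, ENNReal.one_ne_top, false_or]
      exact measure_ball_lt_top.ne
    refine ⟨(max 1 (volume (Metric.ball (0 : E 1) (δ / 2)))).toNNReal,
      fun c p q hp hq hqQ hpq ψ hψ hψc hψs => ?_⟩
    rw [ENNReal.coe_toNNReal hVtop, ← Measure.addHaar_ball_center _ c]
    refine (eLpNorm_restrict_le_max_one_mul (by exact_mod_cast hq) le_top
      hψ.continuous.aestronglyMeasurable).trans ?_
    gcongr
    refine le_trans ?_ le_add_self
    rw [eLpNorm_exponent_top]
    exact eLpNormEssSup_le_of_ae_enorm_bound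
      (ae_of_all _ fun x => enorm_le_eLpNorm_fderiv_one hψ hψc x)
  · obtain ⟨C₁, hC₁⟩ := exists_sobolev_ball hd Q hδ
    obtain ⟨C₂, hC₂⟩ := exists_poincare_one hd hΩb
    refine ⟨C₁ * max 1 C₂, fun c p q hp hq hqQ hpq ψ hψ hψc hψs => ?_⟩
    calc eLpNorm ψ q (volume.restrict (Metric.ball c (δ / 2)))
        ≤ C₁ * (eLpNorm (fderiv ℝ ψ) p (volume.restrict (Metric.ball c δ)) +
            eLpNorm ψ 1 (volume.restrict (Metric.ball c δ))) := hC₁ c p q hp hq hqQ hpq ψ hψ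
      _ ≤ C₁ * (max 1 C₂ * eLpNorm (fderiv ℝ ψ) p (volume.restrict (Metric.ball c δ)) +
            max 1 C₂ * eLpNorm (fderiv ℝ ψ) 1 volume) := by
          gcongr
          · exact le_mul_of_one_le_left' (by exact_mod_cast le_max_left _ _)
          · refine (eLpNorm_mono_measure _ Measure.restrict_le_self).trans
              ((hC₂ ψ hψ hψc hψs).trans ?_)
            gcongr
            exact le_max_right _ _
      _ = _ := by push_cast; ring

end Sobolev
end MusielakOrlicz

/-! ### Modular estimates for test functions. -/

namespace MusielakOrlicz
section Modular
open scoped NNReal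
variable {d : ℕ} {Ω A : Set (E d)} {φ : E d → ℝ → ℝ}

theorem norm_gradient_eq_norm_fderiv (ψ : E d → ℝ) (x : E d) :
    ‖gradient ψ x‖ = ‖fderiv ℝ ψ x‖ :=
  (InnerProductSpace.toDual ℝ (E d)).symm.norm_map _

theorem IsTestFunction.contDiff_one {ψ : E d → ℝ} (hψ : IsTestFunction Ω ψ) : ContDiff ℝ 1 ψ :=
  hψ.1.of_le (by exact_mod_cast le_top)

theorem IsTestFunction.support_fderiv_subset {ψ : E d → ℝ} (hψ : IsTestFunction Ω ψ) :
    Function.support (fderiv ℝ ψ) ⊆ Ω :=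
  ((subset_tsupport _).trans (tsupport_fderiv_subset ℝ)).trans hψ.2.2

theorem IsTestFunction.eLpNorm_fderiv_restrict {ψ : E d → ℝ} (hψ : IsTestFunction Ω ψ)
    (p : ℝ≥0∞) (μ : Measure (E d)) :
    eLpNorm (fderiv ℝ ψ) p (μ.restrict Ω) = eLpNorm (fderiv ℝ ψ) p μ :=
  eLpNorm_restrict_eq_of_support_subset (f := fun x => fderiv ℝ ψ x) hψ.support_fderiv_subset

theorem IsTestFunction.div_const {ψ : E d → ℝ} (hψ : IsTestFunction Ω ψ) (l : ℝ) :
    IsTestFunction Ω (fun x => ψ x / l) := by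
  simp only [div_eq_mul_inv]
  have hs : Function.support (fun x => ψ x * l⁻¹) ⊆ Function.support ψ :=
    Function.support_mul_subset_left _ _
  exact ⟨hψ.1.mul contDiff_const, hψ.2.1.mono hs, (closure_mono hs).trans hψ.2.2⟩

theorem gradient_div_const {ψ : E d → ℝ} (l : ℝ) (x : E d) :
    gradient (fun x => ψ x / l) x = l⁻¹ • gradient ψ x := by
  have : fderiv ℝ (fun x => ψ x / l) x = l⁻¹ • fderiv ℝ ψ x := by
    have e : (fun x => ψ x / l) = l⁻¹ • ψ := by
      ext y; simp [div_eq_inv_mul]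
    rw [e]
    exact congrFun (fderiv_const_smul_field (𝕜 := ℝ) (f := ψ) l⁻¹) x
  rw [gradient, this, gradient, map_smulₛₗ]
  simp

/-- The local lower growth bound: the `L^{p⁻}`-norm of the gradient on `A` is controlled by its
modular. -/
theorem eLpNorm_fderiv_le (h : IsGeneralizedPhi Ω φ) (hΩ : MeasurableSet Ω)
    (hA : MeasurableSet A) (hAΩ : (A ∩ Ω).Nonempty) {b : ℝ} (hb : 0 < b)
    (hN : ∀ᵐ x ∂(volume.restrict Ω), b⁻¹ ≤ Phi φ x 1) {ψ : E d → ℝ}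
    (hψ : IsTestFunction Ω ψ) {K : ℝ≥0∞} (hK : modular Ω φ (fun x => ‖gradient ψ x‖) ≤ K) :
    eLpNorm (fderiv ℝ ψ) (pMinus Ω φ A).toNNReal (volume.restrict A) ≤
      max 1 (volume Ω + ENNReal.ofReal b * K) := by
  set a := pMinus Ω φ A with ha
  have ha1 : 1 ≤ a := h.one_le_pMinus hAΩ
  have ha0 : a.toNNReal ≠ 0 := by simpa using zero_lt_one.trans_le ha1
  have hac : (a.toNNReal : ℝ) = a := Real.coe_toNNReal _ (by linarith)
  rw [← hψ.eLpNorm_fderiv_restrict,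
    Measure.restrict_restrict hΩ, eLpNorm_nnreal_eq_lintegral ha0, hac]
  have hpt : ∀ᵐ x ∂(volume.restrict (Ω ∩ A)), ‖fderiv ℝ ψ x‖ₑ ^ a ≤
      1 + ENNReal.ofReal b * ENNReal.ofReal (Phi φ x |‖gradient ψ x‖|) := by
    have hN' := ae_mono (Measure.restrict_mono (Set.inter_subset_left (s := Ω) (t := A)) le_rfl) hN
    filter_upwards [hN', ae_restrict_mem (hΩ.inter hA)] with x hx hxA
    have h1 := h.rpow_mul_Phi_one_le (A := A) ⟨hxA.2, hxA.1⟩ (norm_nonneg (fderiv ℝ ψ x))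
    have h2 := h.Phi_nonneg hxA.1 (norm_nonneg (fderiv ℝ ψ x))
    rw [abs_of_nonneg (norm_nonneg _), norm_gradient_eq_norm_fderiv, ← ofReal_norm,
      ENNReal.ofReal_rpow_of_nonneg (norm_nonneg _) (by linarith), ← ENNReal.ofReal_one,
      ← ENNReal.ofReal_mul hb.le, ← ENNReal.ofReal_add zero_le_one (by positivity)]
    apply ENNReal.ofReal_le_ofReal
    have h3 := h.Phi_pos hxA.1 one_pos
    have h4 : 1 ≤ b * Phi φ x 1 := by
      rwa [inv_le_iff_one_le_mul₀ hb, mul_comm] at hx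
    have h5 : ‖fderiv ℝ ψ x‖ ^ a * Phi φ x 1 ≤
        (1 + b * Phi φ x ‖fderiv ℝ ψ x‖) * Phi φ x 1 := by nlinarith
    exact le_of_mul_le_mul_right h5 h3
  have hint : ∫⁻ x in Ω ∩ A, ‖fderiv ℝ ψ x‖ₑ ^ a ≤ volume Ω + ENNReal.ofReal b * K := by
    refine (lintegral_mono_ae hpt).trans ?_
    rw [lintegral_add_left measurable_const, lintegral_const, one_mul,
      Measure.restrict_apply_univ, lintegral_const_mul' _ _ ENNReal.ofReal_ne_top]
    gcongr
    · exact Set.inter_subset_left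
    · exact (lintegral_mono_set Set.inter_subset_left).trans hK
  calc _ ≤ (max 1 (volume Ω + ENNReal.ofReal b * K)) ^ (1 / a) := by
        gcongr
        exact hint.trans (le_max_right _ _)
    _ ≤ (max 1 (volume Ω + ENNReal.ofReal b * K)) ^ (1 : ℝ) := by
        apply ENNReal.rpow_le_rpow_of_exponent_le (le_max_left _ _)
        exact (div_le_one (by linarith)).2 ha1
    _ = _ := ENNReal.rpow_one _

/-- The local upper growth bound: the modular on `B ⊆ A` is controlled by the `L^{p⁺}`-norm. -/
theorem setLIntegral_Phi_le (h : IsGeneralizedPhi Ω φ) (hΩ : MeasurableSet Ω) {B : Set (E d)}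
    (hB : MeasurableSet B) (hBA : B ⊆ A) (hAΩ : (A ∩ Ω).Nonempty) {b : ℝ}
    (hN : ∀ᵐ x ∂(volume.restrict Ω), Phi φ x 1 ≤ b) {u : E d → ℝ} {M : ℝ≥0∞}
    (hM : eLpNorm u (pPlus Ω φ A).toNNReal (volume.restrict B) ≤ M) :
    ∫⁻ x in B ∩ Ω, ENNReal.ofReal (Phi φ x |u x|) ≤
      ENNReal.ofReal b * (volume Ω + (max 1 M) ^ pPlus Ω φ Ω) := by
  set q := pPlus Ω φ A with hq
  have hq1 : 1 ≤ q := (h.one_le_pMinus hAΩ).trans (h.pMinus_le_pPlus hAΩ)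
  have hqq : q ≤ pPlus Ω φ Ω := h.pPlus_le hAΩ
  have hq0 : q.toNNReal ≠ 0 := by simpa using zero_lt_one.trans_le hq1
  have hqc : (q.toNNReal : ℝ) = q := Real.coe_toNNReal _ (by linarith)
  rw [eLpNorm_nnreal_eq_lintegral hq0, hqc, one_div,
    ENNReal.rpow_inv_le_iff (by linarith)] at hM
  have hpt : ∀ᵐ x ∂(volume.restrict (B ∩ Ω)), ENNReal.ofReal (Phi φ x |u x|) ≤
      ENNReal.ofReal b * (1 + ‖u x‖ₑ ^ q) := by
    have hN' := ae_mono (Measure.restrict_mono (Set.inter_subset_right (s := B) (t := Ω)) le_rfl) hN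
    filter_upwards [hN', ae_restrict_mem (hB.inter hΩ)] with x hx hxA
    have h1 := h.Phi_le_mul_one_add_rpow (A := A) ⟨hBA hxA.1, hxA.2⟩ (abs_nonneg (u x))
    have h3 := h.Phi_pos hxA.2 one_pos
    have h4 : 0 ≤ |u x| ^ q := by positivity
    rw [← ofReal_norm, ENNReal.ofReal_rpow_of_nonneg (norm_nonneg _) (by linarith),
      ← ENNReal.ofReal_one, ← ENNReal.ofReal_add zero_le_one (by positivity),
      ← ENNReal.ofReal_mul (by linarith)]
    apply ENNReal.ofReal_le_ofReal
    refine h1.trans ?_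
    rw [Real.norm_eq_abs]
    gcongr
  refine (lintegral_mono_ae hpt).trans ?_
  rw [lintegral_const_mul' _ _ ENNReal.ofReal_ne_top, lintegral_add_left measurable_const,
    lintegral_const, one_mul, Measure.restrict_apply_univ]
  gcongr
  · exact Set.inter_subset_right
  · calc ∫⁻ x in B ∩ Ω, ‖u x‖ₑ ^ q ≤ ∫⁻ x in B, ‖u x‖ₑ ^ q :=
          lintegral_mono_set Set.inter_subset_left
      _ ≤ M ^ q := hM
      _ ≤ (max 1 M) ^ q := by gcongr; exact le_max_right _ _
      _ ≤ _ := ENNReal.rpow_le_rpow_of_exponent_le (le_max_left _ _) hqq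

/-- The modular form of the inequality for test functions. -/
theorem exists_modular_bound (hd : 1 ≤ d) (hΩ : IsOpen Ω) (hΩb : Bornology.IsBounded Ω)
    {δ : ℝ} (hδ : 0 < δ) (pp : ℝ) {β : ℝ} (hβ : 0 < β) (K : ℝ≥0) :
    ∃ C : ℝ≥0, ∀ φ : E d → ℝ → ℝ, IsGeneralizedPhi Ω φ → pPlus Ω φ Ω = pp →
      Normalized Ω φ β → JumpCondition Ω φ δ → ∀ ψ : E d → ℝ, IsTestFunction Ω ψ →
        modular Ω φ (fun x => ‖gradient ψ x‖) ≤ K → modular Ω φ ψ ≤ C := by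
  obtain ⟨S, hS⟩ := exists_sobolev_poincare hd hΩb pp.toNNReal hδ
  -- The centres must lie in `Ω`, where the jump condition is available.
  obtain ⟨T, hTΩ, hTfin, hT⟩ : ∃ T ⊆ Ω, T.Finite ∧ Ω ⊆ ⋃ y ∈ T, Metric.ball y (δ / 2) := by
    obtain ⟨T, h1, h2, h3⟩ := totallyBounded_iff_subset.1
      (hΩb.isCompact_closure.totallyBounded.subset subset_closure) _ (Metric.dist_mem_uniformity (half_pos hδ))
    exact ⟨T, h1, h2, h3⟩
  have hvol : volume Ω ≠ ⊤ := hΩb.measure_lt_top.ne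
  set b : ℝ := β ^ (-pp) with hbdef
  have hb : 0 < b := Real.rpow_pos_of_pos hβ _
  -- `M₁` bounds `∇ψ` in `L^(p⁻)` on any set, `M₂` bounds `ψ` in `L^(p⁺)` on a half ball, and `M₃`
  -- bounds its modular there.
  set M₁ : ℝ≥0∞ := max 1 (volume Ω + ENNReal.ofReal b * K) with hM₁
  set M₂ : ℝ≥0∞ := S * (M₁ + max 1 (volume Ω) * M₁) with hM₂
  have hmax : ∀ {a : ℝ≥0∞}, a ≠ ⊤ → max 1 a ≠ ⊤ := fun ha => by
    simp [ha]
  have hM₁t : M₁ ≠ ⊤ := hmax (by finiteness)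
  have hM₂t : M₂ ≠ ⊤ := by
    have := hmax hvol
    simp only [hM₂]; finiteness
  set M₃ : ℝ≥0∞ := ENNReal.ofReal b * (volume Ω + (max 1 M₂) ^ pp) with hM₃
  have hM₃t : M₃ ≠ ⊤ := by
    have h1 := hmax hM₂t
    have h2 : (max 1 M₂) ^ pp ≠ ⊤ :=
      ENNReal.rpow_ne_top_of_ne_zero (one_pos.trans_le (le_max_left _ _)).ne' h1
    simp only [hM₃]; finiteness
  refine ⟨(hTfin.toFinset.card * M₃).toNNReal, fun φ h hpp hN hJ ψ hψ hK => ?_⟩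
  rw [ENNReal.coe_toNNReal (by finiteness)]
  have hN1 : ∀ᵐ x ∂(volume.restrict Ω), b⁻¹ ≤ Phi φ x 1 := hN.mono fun x hx => by
    rw [hbdef, Real.rpow_neg hβ.le, inv_inv, ← hpp]; exact hx.1
  have hN2 : ∀ᵐ x ∂(volume.restrict Ω), Phi φ x 1 ≤ b := hN.mono fun x hx => by
    rw [hbdef, ← hpp]; exact hx.2
  have hgrad : ∀ {A : Set (E d)}, MeasurableSet A → (A ∩ Ω).Nonempty →
      eLpNorm (fderiv ℝ ψ) (pMinus Ω φ A).toNNReal (volume.restrict A) ≤ M₁ :=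
    fun hA hAΩ => eLpNorm_fderiv_le h hΩ.measurableSet hA hAΩ hb hN1 hψ hK
  have hball : ∀ y ∈ T,
      ∫⁻ x in Metric.ball y (δ / 2) ∩ Ω, ENNReal.ofReal (Phi φ x |ψ x|) ≤ M₃ := by
    intro y hy
    have hyB : (Metric.ball y δ ∩ Ω).Nonempty := ⟨y, Metric.mem_ball_self hδ, hTΩ hy⟩
    have hyΩ : (Ω ∩ Ω).Nonempty := ⟨y, hTΩ hy, hTΩ hy⟩
    have hp1 := h.one_le_pMinus hyB
    have hpq := h.pMinus_le_pPlus hyB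
    have hqQ := h.pPlus_le hyB
    have hpc : ((pMinus Ω φ (Metric.ball y δ)).toNNReal : ℝ) = _ :=
      Real.coe_toNNReal _ (zero_le_one.trans hp1)
    have hqc : ((pPlus Ω φ (Metric.ball y δ)).toNNReal : ℝ) = _ :=
      Real.coe_toNNReal _ (zero_le_one.trans (hp1.trans hpq))
    -- The lower growth bound with `A = Ω` controls the global `L¹` norm of the gradient.
    have hone : eLpNorm (fderiv ℝ ψ) 1 volume ≤ max 1 (volume Ω) * M₁ := by
      rw [← hψ.eLpNorm_fderiv_restrict]
      refine (eLpNorm_restrict_le_max_one_mul le_rfl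
        (q := ((pMinus Ω φ Ω).toNNReal : ℝ≥0∞)) ?_
        (hψ.contDiff_one.continuous_fderiv one_ne_zero).aestronglyMeasurable).trans ?_
      · have := h.one_le_pMinus hyΩ
        exact_mod_cast Real.one_le_toNNReal.2 this
      · gcongr
        exact hgrad hΩ.measurableSet hyΩ
    have hsob := hS y (pMinus Ω φ (Metric.ball y δ)).toNNReal
      (pPlus Ω φ (Metric.ball y δ)).toNNReal (Real.one_le_toNNReal.2 hp1)
      (Real.one_le_toNNReal.2 (hp1.trans hpq)) (Real.toNNReal_le_toNNReal (hpp ▸ hqQ))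
      (by rw [hpc, hqc]; exact hJ y (hTΩ hy)) ψ hψ.contDiff_one hψ.2.1 hψ.2.2
    have hM : eLpNorm ψ (pPlus Ω φ (Metric.ball y δ)).toNNReal
        (volume.restrict (Metric.ball y (δ / 2))) ≤ M₂ := by
      refine hsob.trans ?_
      simp only [hM₂]
      gcongr
      exact hgrad measurableSet_ball hyB
    have := setLIntegral_Phi_le h hΩ.measurableSet measurableSet_ball
      (Metric.ball_subset_ball (by linarith)) hyB hN2 hM
    rwa [hpp] at this
  calc modular Ω φ ψ
      ≤ ∫⁻ x in ⋃ y : T, (Metric.ball (y : E d) (δ / 2) ∩ Ω),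
          ENNReal.ofReal (Phi φ x |ψ x|) := by
        refine lintegral_mono_set fun x hx => ?_
        obtain ⟨y, hy, hxy⟩ := Set.mem_iUnion₂.1 (hT hx)
        exact Set.mem_iUnion.2 ⟨⟨y, hy⟩, hxy, hx⟩
    _ ≤ ∑' y : T, ∫⁻ x in Metric.ball (y : E d) (δ / 2) ∩ Ω,
          ENNReal.ofReal (Phi φ x |ψ x|) := by
        have := hTfin.countable.to_subtype
        exact lintegral_iUnion_le _ _
    _ ≤ ∑' _ : T, M₃ := ENNReal.tsum_le_tsum fun y => hball y y.2
    _ = hTfin.toFinset.card * M₃ := by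
        have := hTfin.fintype
        rw [tsum_fintype, Finset.sum_const, Finset.card_univ, nsmul_eq_mul,
          ← Set.toFinset_card, Set.Finite.toFinset_eq_toFinset]

/-! ### From test functions to `W₀^{1,Φ}`, and from modulars to norms. -/

theorem norm_le_sum_abs (v : E d) : ‖v‖ ≤ ∑ k, |v k| := by
  conv_lhs => rw [← (EuclideanSpace.basisFun (Fin d) ℝ).sum_repr v]
  refine (norm_sum_le _ _).trans (Finset.sum_le_sum fun k _ => ?_)
  rw [norm_smul]
  simp

namespace IsGeneralizedPhi

theorem Phi_sum_le (h : IsGeneralizedPhi Ω φ) (hd : 1 ≤ d) {x : E d} (hx : x ∈ Ω)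
    {f : Fin d → ℝ} (hf : ∀ k, 0 ≤ f k) :
    Phi φ x (∑ k, f k) ≤ (d : ℝ) ^ pPlus Ω φ Ω * ∑ k, Phi φ x (f k) := by
  have : Nonempty (Fin d) := ⟨⟨0, hd⟩⟩
  obtain ⟨m, hm⟩ := Finite.exists_max f
  calc Phi φ x (∑ k, f k) ≤ Phi φ x (d * f m) := by
        refine h.Phi_mono hx (Finset.sum_nonneg fun k _ => hf k) ?_
        refine (Finset.sum_le_sum fun k _ => hm k).trans ?_
        simp
    _ ≤ (d : ℝ) ^ pPlus Ω φ Ω * Phi φ x (f m) :=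
        h.Phi_mul_le ⟨hx, hx⟩ (hf m) (by exact_mod_cast hd)
    _ ≤ _ := by
        gcongr
        exact Finset.single_le_sum (f := fun k => Phi φ x (f k))
          (fun k _ => h.Phi_nonneg hx (hf k)) (Finset.mem_univ m)

theorem modular_le_of_abs_le_add (h : IsGeneralizedPhi Ω φ) (hΩ : MeasurableSet Ω)
    {w u v : E d → ℝ} (hu : AEMeasurable u (volume.restrict Ω))
    (hw : ∀ x, |w x| ≤ |u x| + |v x|) :
    modular Ω φ w ≤ ENNReal.ofReal (2 ^ pPlus Ω φ Ω) * (modular Ω φ u + modular Ω φ v) := by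
  have hm : AEMeasurable (fun x => ENNReal.ofReal (Phi φ x |u x|)) (volume.restrict Ω) :=
    (h.aemeasurable_Phi_comp hΩ (f := fun x => |u x|)
      (measurable_norm.comp_aemeasurable hu) fun x => abs_nonneg _).ennreal_ofReal
  rw [modular, modular, modular, ← lintegral_add_left' hm,
    ← lintegral_const_mul' _ _ ENNReal.ofReal_ne_top]
  refine setLIntegral_mono' hΩ fun x hx => ?_
  rw [← ENNReal.ofReal_add (h.Phi_nonneg hx (abs_nonneg _)) (h.Phi_nonneg hx (abs_nonneg _)),
    ← ENNReal.ofReal_mul (by positivity)]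
  exact ENNReal.ofReal_le_ofReal ((h.Phi_mono hx (abs_nonneg _) (hw x)).trans
    (h.Phi_add_le hx (abs_nonneg _) (abs_nonneg _)))

/-- Needed because the `W^{1,Φ}` norm measures the partial derivatives separately, while the
inequality involves `|∇u|`. -/
theorem modular_norm_le_sum (h : IsGeneralizedPhi Ω φ) (hd : 1 ≤ d) (hΩ : MeasurableSet Ω)
    {g : E d → E d} (hg : AEMeasurable g (volume.restrict Ω)) :
    modular Ω φ (fun x => ‖g x‖) ≤
      ENNReal.ofReal ((d : ℝ) ^ pPlus Ω φ Ω) * ∑ k, modular Ω φ (fun x => g x k) := by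
  have hm : ∀ k ∈ (Finset.univ : Finset (Fin d)),
      AEMeasurable (fun x => ENNReal.ofReal (Phi φ x |g x k|)) (volume.restrict Ω) := fun k _ =>
    (h.aemeasurable_Phi_comp hΩ (f := fun x => |g x k|)
      (measurable_norm.comp_aemeasurable
        ((EuclideanSpace.proj (𝕜 := ℝ) k).measurable.comp_aemeasurable hg))
      fun x => abs_nonneg _).ennreal_ofReal
  simp only [modular]
  rw [← lintegral_finsetSum' _ hm, ← lintegral_const_mul' _ _ ENNReal.ofReal_ne_top]
  refine setLIntegral_mono' hΩ fun x hx => ?_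
  rw [← ENNReal.ofReal_sum_of_nonneg fun k _ => h.Phi_nonneg hx (abs_nonneg _),
    ← ENNReal.ofReal_mul (by positivity), abs_of_nonneg (norm_nonneg _)]
  exact ENNReal.ofReal_le_ofReal ((h.Phi_mono hx (norm_nonneg _) (norm_le_sum_abs _)).trans
    (h.Phi_sum_le hd hx fun k => abs_nonneg _))

/-- A bound for the modular of `u` yields one for the Luxemburg norm. -/
theorem modular_div_le_one (h : IsGeneralizedPhi Ω φ) (hΩ : MeasurableSet Ω) {u : E d → ℝ}
    {c : ℝ} (hc : 1 ≤ c) (hu : modular Ω φ u ≤ ENNReal.ofReal c) :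
    modular Ω φ (fun x => u x / c) ≤ 1 := by
  have hc0 : 0 < c := one_pos.trans_le hc
  have hne : ENNReal.ofReal c ≠ 0 := by simpa using hc0
  have key : ENNReal.ofReal c * modular Ω φ (fun x => u x / c) ≤ modular Ω φ u := by
    rw [modular, modular, ← lintegral_const_mul' _ _ ENNReal.ofReal_ne_top]
    refine setLIntegral_mono' hΩ fun x hx => ?_
    rw [← ENNReal.ofReal_mul hc0.le]
    apply ENNReal.ofReal_le_ofReal
    have h0 := abs_nonneg (u x / c)
    have h1 := h.rpow_mul_Phi_le (A := Ω) ⟨hx, hx⟩ h0 hc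
    have h2 : c * |u x / c| = |u x| := by
      rw [abs_div, abs_of_pos hc0]; field_simp
    rw [h2] at h1
    refine le_trans ?_ h1
    have h3 : c ≤ c ^ pMinus Ω φ Ω :=
      Real.self_le_rpow_of_one_le hc (h.one_le_pMinus ⟨x, hx, hx⟩)
    have := h.Phi_nonneg hx h0
    gcongr
  have := (key.trans hu).trans_eq (mul_one _).symm
  exact (ENNReal.mul_le_mul_iff_right hne ENNReal.ofReal_ne_top).1 this

end IsGeneralizedPhi

/-- The modular form of the inequality in `W₀^{1,Φ}`. -/
theorem exists_modular_bound_of_memW1PhiZero (hd : 1 ≤ d) (hΩ : IsOpen Ω)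
    (hΩb : Bornology.IsBounded Ω) {δ : ℝ} (hδ : 0 < δ) (pp : ℝ) {β : ℝ} (hβ : 0 < β) :
    ∃ C : ℝ, 1 ≤ C ∧ ∀ φ : E d → ℝ → ℝ, IsGeneralizedPhi Ω φ → pPlus Ω φ Ω = pp →
      Normalized Ω φ β → JumpCondition Ω φ δ → ∀ (u : E d → ℝ) (g : E d → E d),
        MemW1PhiZero Ω φ u g → ∀ l : ℝ, 0 < l → modular Ω φ (fun x => ‖g x‖ / l) ≤ 1 →
          modular Ω φ (fun x => u x / l) ≤ ENNReal.ofReal C := by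
  set D : ℝ≥0∞ := ENNReal.ofReal (2 ^ pp)
  -- `K` bounds the modular of `∇ψ / l`: one summand for `g / l`, one for the approximation error,
  -- and `D` from the quasi-triangle inequality.
  set K : ℝ≥0∞ := D * (1 + ENNReal.ofReal ((d : ℝ) ^ pp) * 1) with hK
  have hKt : K ≠ ⊤ := by simp only [hK]; finiteness
  obtain ⟨C, hC⟩ := exists_modular_bound hd hΩ hΩb hδ pp hβ K.toNNReal
  have hCt : D * (C + 1) ≠ ⊤ := by finiteness
  refine ⟨max 1 (D * (C + 1)).toReal, le_max_left _ _,
    fun φ h hpp hN hJ u g hu l hl hgl => ?_⟩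
  have hΩm := hΩ.measurableSet
  -- The error divided by some `r < l` has modular at most `1`; dividing by the larger `l` only
  -- decreases it.
  obtain ⟨ψ, hψ, hψu⟩ := hu.2 (ENNReal.ofReal l) (by simpa using hl)
  obtain ⟨_, ⟨r, hr, rfl, hmr⟩, hrl⟩ := sInf_lt_iff.1 hψu
  have hrl : r ≤ l := ((ENNReal.ofReal_lt_ofReal_iff hl).1 hrl).le
  have hgm : AEMeasurable g (volume.restrict Ω) := hu.1.2.1.2.1.aemeasurable
  have hgradm : Measurable (gradient ψ) :=
    ((InnerProductSpace.toDual ℝ (E d)).symm.continuous.comp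
      (hψ.contDiff_one.continuous_fderiv one_ne_zero)).measurable
  have hle : ∀ a : ℝ, |a / l| ≤ |a / r| := fun a => by
    rw [abs_div, abs_div, abs_of_pos hl, abs_of_pos hr]
    gcongr
  have h1 : modular Ω φ (fun x => (u x - ψ x) / r) ≤ 1 := le_self_add.trans hmr
  have h2 : ∑ k, modular Ω φ (fun x => (r⁻¹ • (g x - gradient ψ x)) k) ≤ 1 :=
    le_add_self.trans hmr
  have h3 : modular Ω φ (fun x => ‖gradient (fun x => ψ x / l) x‖) ≤ K.toNNReal := by
    rw [ENNReal.coe_toNNReal hKt]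
    refine (h.modular_le_of_abs_le_add hΩm (u := fun x => ‖g x‖ / l)
      (v := fun x => ‖r⁻¹ • (g x - gradient ψ x)‖) (hgm.norm.div_const _) fun x => ?_).trans ?_
    · rw [gradient_div_const, abs_of_nonneg (norm_nonneg _), abs_of_nonneg (norm_nonneg _),
        abs_of_nonneg (by positivity), norm_smul, norm_smul, norm_inv, norm_inv,
        Real.norm_of_nonneg hl.le, Real.norm_of_nonneg hr.le, ← div_eq_inv_mul, ← div_eq_inv_mul]
      have e1 : ‖gradient ψ x‖ ≤ ‖g x‖ + ‖g x - gradient ψ x‖ := by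
        simpa using norm_sub_le (g x) (g x - gradient ψ x)
      calc ‖gradient ψ x‖ / l ≤ (‖g x‖ + ‖g x - gradient ψ x‖) / l := by gcongr
        _ = ‖g x‖ / l + ‖g x - gradient ψ x‖ / l := add_div _ _ _
        _ ≤ _ := by gcongr
    · rw [hpp, hK]
      gcongr
      refine (h.modular_norm_le_sum hd hΩm
        ((hgm.sub hgradm.aemeasurable).const_smul r⁻¹)).trans ?_
      rw [hpp]
      gcongr
      exact h2
  have h4 := hC φ h hpp hN hJ _ (hψ.div_const l) h3
  calc modular Ω φ (fun x => u x / l)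
      ≤ D * (modular Ω φ (fun x => ψ x / l) + modular Ω φ (fun x => (u x - ψ x) / r)) := by
        have := h.modular_le_of_abs_le_add hΩm (w := fun x => u x / l)
          (u := fun x => ψ x / l) (v := fun x => (u x - ψ x) / r)
          (hψ.1.continuous.div_const l).measurable.aemeasurable fun x => by
            calc |u x / l| = |ψ x / l + (u x - ψ x) / l| := by congr 1; ring
              _ ≤ |ψ x / l| + |(u x - ψ x) / l| := abs_add_le _ _
              _ ≤ _ := by gcongr _ + ?_; exact hle _
        rwa [hpp] at this
    _ ≤ D * (C + 1) := by gcongr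
    _ = ENNReal.ofReal (D * (C + 1)).toReal := (ENNReal.ofReal_toReal hCt).symm
    _ ≤ _ := ENNReal.ofReal_le_ofReal (le_max_right _ _)

end Modular
end MusielakOrlicz

theorem mainTheorem5 (d : ℕ) (hd : 1 ≤ d) (Ω : Set (MusielakOrlicz.E d)) (hΩ : IsOpen Ω)
    (hΩb : Bornology.IsBounded Ω) (δ : ℝ) (hδ : 0 < δ) (pm pp : ℝ)
    (β : ℝ) (hβ : 0 < β) (hβ1 : β ≤ 1) :
    ∃ c : ℝ, 0 < c ∧ ∀ φ : MusielakOrlicz.E d → ℝ → ℝ,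
      MusielakOrlicz.IsGeneralizedPhi Ω φ →
      MusielakOrlicz.pMinus Ω φ Ω = pm →
      MusielakOrlicz.pPlus Ω φ Ω = pp →
      MusielakOrlicz.Normalized Ω φ β →
      MusielakOrlicz.JumpCondition Ω φ δ →
      ∀ (u : MusielakOrlicz.E d → ℝ) (g : MusielakOrlicz.E d → MusielakOrlicz.E d),
        MusielakOrlicz.MemW1PhiZero Ω φ u g →
        MusielakOrlicz.normPhi Ω φ u ≤
          ENNReal.ofReal c * MusielakOrlicz.normPhi Ω φ (fun x => ‖g x‖) := by
  obtain ⟨c, hc, H⟩ :=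
    MusielakOrlicz.exists_modular_bound_of_memW1PhiZero hd hΩ hΩb hδ pp hβ
  have hc0 : 0 < c := one_pos.trans_le hc
  have hne : ENNReal.ofReal c ≠ 0 := by simpa using hc0
  refine ⟨c, hc0, fun φ h _ hpp hN hJ u g hu => ?_⟩
  -- With `c` moved to the left, the right side is a bare infimum, so each `l` admissible for `|∇u|`
  -- can be tested: then `l * c` is admissible for `u`.
  rw [mul_comm, ← ENNReal.div_le_iff hne ENNReal.ofReal_ne_top]
  refine le_sInf ?_
  rintro _ ⟨l, hl, rfl, hgl⟩
  rw [ENNReal.div_le_iff hne ENNReal.ofReal_ne_top, ← ENNReal.ofReal_mul hl.le]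
  refine sInf_le ⟨l * c, by positivity, rfl, ?_⟩
  have := h.modular_div_le_one hΩ.measurableSet hc (H φ h hpp hN hJ u g hu l hl hgl)
  simpa only [div_div] using this
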